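/- Let $p$ be a prime, $K$ a complete non-archimedean field extension of $\mathbf{Q}_p$ (for instance $K=\mathbf{Q}_p$), and $S\neq 0$ a reduced affinoid $K$-algebra, equipped with a complete non-archimedean $K$-algebra norm. Let $\overline S$ be the maximal étale extension of $S$, i.e. the increasing union of finite étale extensions of $S$ that has the same idempotents as $S$ and over which every finite étale covering has a section. For $x\in\overline S$ let $|x|_{\rm sp}=\lim_k\|x^k\|^{1/k}$ be the spectral seminorm (computed in any finite $S$-subalgebra containing $x$, with its canonical topology), $\mathcal O_{\overline S}=\{x\in\overline S : |x|_{\rm sp}\le 1\}$, and $\widehat{\mathcal O}_{\overline S}$ the $p$-adic completion of $\mathcal O_{\overline S}$. Equip $\widehat{\mathcal O}_{\overline S}[\frac1p]$ with the Banach topology for which the subgroups $p^m\widehat{\mathcal O}_{\overline S}$ form a basis of neighbourhoods of $0$. Let $\mathbf A_{\rm inf}(\overline S)=W(\widehat{\mathcal O}_{\overline S}^{\flat})$, where $\widehat{\mathcal O}_{\overline S}^{\flat}=\varprojlim_{x\mapsto x^p}\widehat{\mathcal O}_{\overline S}/p$, with Fontaine's map $\theta:\mathbf A_{\rm inf}(\overline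 S)[\frac1p]\to\widehat{\mathcal O}_{\overline S}[\frac1p]$. Let $\mathbf B_{\rm dR}^+(\overline S)=\varprojlim_n \mathbf A_{\rm inf}(\overline S)[\frac1p]/(\mathrm{Ker}\,\theta)^n$, equipped with the projective limit topology, where in $\mathbf A_{\rm inf}(\overline S)[\frac1p]/(\mathrm{Ker}\,\theta)^n$ the images of the $p^m\mathbf A_{\rm inf}(\overline S)$ form a basis of neighbourhoods of $0$; extend $\theta$ to $\theta:\mathbf B_{\rm dR}^+(\overline S)\to\widehat{\mathcal O}_{\overline S}[\frac1p]$. A thickening of $\widehat{\mathcal O}_{\overline S}[\frac1p]$ is a continuous surjective ring homomorphism $\theta_B:B\to\widehat{\mathcal O}_{\overline S}[\frac1p]$, with $B$ a commutative (non-archimedean) Banach $\mathbf{Q}_p$-algebra, such that $(\mathrm{Ker}\,\theta_B)^{k+1}=0$ for some $k\in\mathbf N$ (no $S$-algebra structure on $B$ is required). Théorème 4. $\mathbf B_{\rm dR}^+(\overline S)$ is the universal thickening of $\widehat{\mathcal O}_{\overline S}[\frac1p]$: the map $\theta:\mathbf B_{\rm dR}^+(\overline S)\to\widehat{\mathcal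 O}_{\overline S}[\frac1p]$ is continuous and surjective, and for every thickening $\theta_B:B\to\widehat{\mathcal O}_{\overline S}[\frac1p]$ there is a unique continuous ring homomorphism $\alpha:\mathbf B_{\rm dR}^+(\overline S)\to B$ such that $\theta_B\circ\alpha=\theta$. (When $S$ is a finite extension of $\mathbf Q_p$, $\overline S$ is an algebraic closure of $S$ and $\widehat{\mathcal O}_{\overline S}[\frac1p]=\mathbf C_p$, so $\mathbf B_{\rm dR}^+$ is the universal thickening of $\mathbf C_p$.) -/

import Mathlib

open Filter Topology
open scoped ENNReal NNReal

namespace BdRThick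

universe u v

/-! ### Affinoid algebras -/

/-- The Tate algebra `K⟨T₁, …, Tₙ⟩`: power series in `n` variables whose coefficients tend to `0`. -/
abbrev TateAlgebra (K : Type*) [NormedField K] [IsUltrametricDist K] (n : ℕ) :
    Subring (MvPowerSeries (Fin n) K) :=
  MvPowerSeries.IsRestricted.subring (fun _ : Fin n => (1 : ℝ))

/-- `S` is an affinoid `K`-algebra: it is a quotient, as a `K`-algebra, of a Tate algebra. -/
def IsAffinoid (K : Type*) [NormedField K] [IsUltrametricDist K]
    (S : Type*) [CommRing S] [Algebra K S] : Prop :=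
  ∃ (n : ℕ) (π : TateAlgebra K n →+* S), Function.Surjective π ∧
    ∀ a : K, π ⟨MvPowerSeries.C a, MvPowerSeries.isRestricted_C _ a⟩ = algebraMap K S a

/-! ### The maximal étale extension -/

/-- `T` is the maximal étale extension of `S`: it is an increasing union of finite étale
extensions of `S`, it has the same connected components as `S` (idempotents come from `S`, and no
component is lost), and it has no further étale extension, i.e. every
finite étale covering of `T` has a section.  For `S` connected this says that
`Spec T` is the universal (pro-)finite étale covering of `Spec S`. -/
class IsMaximalEtaleExtension (S : Type u) (T : Type v) [CommRing S] [CommRing T] [Algebra S T] :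
    Prop where
  injective : Function.Injective (algebraMap S T)
  exists_finite_etale : ∀ F : Finset T, ∃ A : Subalgebra S T,
    (F : Set T) ⊆ A ∧ Module.Finite S A ∧ Algebra.Etale S A
  idempotent : ∀ e : T, IsIdempotentElem e → ∃ e₀ : S, IsIdempotentElem e₀ ∧ algebraMap S T e₀ = e
  exists_section : ∀ (U : Type v) [CommRing U] [Algebra T U] [Module.Finite T U]
    [Algebra.Etale T U] [Module.FaithfullyFlat T U], Nonempty (U →ₐ[T] T)

theorem IsMaximalEtaleExtension.isIntegral (S : Type u) (T : Type v) [CommRing S] [CommRing T]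
    [Algebra S T] [IsMaximalEtaleExtension S T] :
    Algebra.IsIntegral S T := by
  refine ⟨fun x => ?_⟩
  obtain ⟨A, hA, hfin, -⟩ := IsMaximalEtaleExtension.exists_finite_etale (S := S) {x}
  have hx : x ∈ A := hA (by simp)
  exact (Algebra.IsIntegral.isIntegral (R := S) (⟨x, hx⟩ : A)).map A.val

/-! ### The spectral seminorm and the ring of integers -/

section Spectral

variable {S : Type u} [NormedCommRing S] {T : Type v} [CommRing T] [Algebra S T]

variable (S) in
/-- The residue norm on the `S`-module generated by a finite family `e` : the infimum of
`max ‖sᵢ‖` over all ways to write `x = ∑ sᵢ eᵢ` (and `∞` if there is none). -/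
noncomputable def residueNorm {n : ℕ} (e : Fin n → T) (x : T) : ℝ≥0∞ :=
  ⨅ (s : Fin n → S) (_ : ∑ i, s i • e i = x), ‖s‖ₑ

variable (S) in
/-- The spectral seminorm `|x|_sp = lim ‖xᵏ‖^(1/k)` of an element `x` of an `S`-algebra `T`, where
`‖ ‖` is the canonical (residue) norm of a finitely generated `S`-submodule of `T` that contains the
powers of `x`.  Over an affinoid algebra the value does not depend on this submodule, since
all its finitely generated submodules are closed and strictly embedded; submodules that do not
contain the powers of `x` contribute `∞`.  For `T = S` it is the usual `lim ‖xᵏ‖^(1/k)`.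
In terms of valuations, `v_sp(x) ≥ 0` means `|x|_sp ≤ 1`. -/
noncomputable def spectralSeminorm (x : T) : ℝ≥0∞ :=
  ⨅ (n : ℕ) (e : Fin n → T),
    limsup (fun k : ℕ => residueNorm S e (x ^ k) ^ (1 / (k : ℝ))) atTop

/-- `x` has a decomposition with coefficients of norm at most `c`. -/
def Bd (S : Type u) [NormedCommRing S] {T : Type v} [CommRing T] [Algebra S T]
    {ι : Type} [Fintype ι] (e : ι → T) (c : ℝ) (x : T) : Prop :=
  ∃ s : ι → S, ∑ i, s i • e i = x ∧ ∀ i, ‖s i‖ ≤ c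

/-- `‖xᵏ‖ ≤ C rᵏ` for all `k`, for some finite family and some constant `C`. -/
def GrowthBd (S : Type u) [NormedCommRing S] {T : Type v} [CommRing T] [Algebra S T]
    (x : T) (r : ℝ) : Prop :=
  ∃ (ι : Type) (_ : Fintype ι) (e : ι → T) (C : ℝ), 0 ≤ C ∧ ∀ k : ℕ, Bd S e (C * r ^ k) (x ^ k)

theorem Bd.mono {ι : Type} [Fintype ι] {e : ι → T} {c d : ℝ} {x : T} (h : Bd S e c x)
    (hcd : c ≤ d) : Bd S e d x := by
  obtain ⟨s, hs, hc⟩ := h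
  exact ⟨s, hs, fun i => (hc i).trans hcd⟩

theorem Bd.inl {ι κ : Type} [Fintype ι] [Fintype κ] {e : ι → T} {f : κ → T} {c : ℝ} {x : T}
    (h : Bd S e c x) (h0 : 0 ≤ c) : Bd S (Sum.elim e f) c x := by
  obtain ⟨s, hs, hc⟩ := h
  refine ⟨Sum.elim s 0, by simpa using hs, ?_⟩
  rintro (i | i)
  · exact hc i
  · simpa using h0

theorem Bd.inr {ι κ : Type} [Fintype ι] [Fintype κ] {e : ι → T} {f : κ → T} {c : ℝ} {x : T}
    (h : Bd S f c x) (h0 : 0 ≤ c) : Bd S (Sum.elim e f) c x := by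
  obtain ⟨s, hs, hc⟩ := h
  refine ⟨Sum.elim 0 s, by simpa using hs, ?_⟩
  rintro (i | i)
  · simpa using h0
  · exact hc i

theorem Bd.mul {ι κ : Type} [Fintype ι] [Fintype κ] {e : ι → T} {f : κ → T} {c d : ℝ} {x y : T}
    (h : Bd S e c x) (h' : Bd S f d y) (hc0 : 0 ≤ c) :
    Bd S (fun i : ι × κ => e i.1 * f i.2) (c * d) (x * y) := by
  obtain ⟨s, hs, hc⟩ := h
  obtain ⟨t, ht, hd⟩ := h'
  refine ⟨fun i => s i.1 * t i.2, ?_, fun i => ?_⟩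
  · rw [← hs, ← ht, Finset.sum_mul_sum, Fintype.sum_prod_type]
    refine Finset.sum_congr rfl fun i _ => Finset.sum_congr rfl fun j _ => ?_
    rw [smul_mul_smul_comm]
  · exact (norm_mul_le _ _).trans (mul_le_mul (hc _) (hd _) (norm_nonneg _) hc0)

theorem Bd.neg {ι : Type} [Fintype ι] {e : ι → T} {c : ℝ} {x : T} (h : Bd S e c x) :
    Bd S e c (-x) := by
  obtain ⟨s, hs, hc⟩ := h
  refine ⟨-s, by simp [hs], fun i => by simpa using hc i⟩

theorem Bd.basis {ι : Type} [Fintype ι] (e : ι → T) (i : ι) : Bd S e ‖(1 : S)‖ (e i) := by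
  classical
  refine ⟨Pi.single i 1, ?_, fun j => ?_⟩
  · simp [Pi.single_apply]
  · by_cases h : j = i
    · subst h; simp
    · simp [h]

theorem Bd.zero {ι : Type} [Fintype ι] (e : ι → T) {c : ℝ} (h : 0 ≤ c) : Bd S e c 0 :=
  ⟨0, by simp, fun _ => by simpa using h⟩

theorem Bd.smul {ι : Type} [Fintype ι] {e : ι → T} {c : ℝ} {x : T} (a : S) (h : Bd S e c x) :
    Bd S e (‖a‖ * c) (a • x) := by
  obtain ⟨s, hs, hc⟩ := h
  refine ⟨fun i => a * s i, by simp [← hs, Finset.smul_sum, mul_smul], fun i => ?_⟩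
  exact (norm_mul_le _ _).trans (mul_le_mul_of_nonneg_left (hc i) (norm_nonneg _))

theorem bd_of_residueNorm_le {n : ℕ} {e : Fin n → T} {x : T} {c : ℝ}
    (h : residueNorm S e x < ENNReal.ofReal c) : Bd S e c x := by
  simp only [residueNorm, iInf_lt_iff] at h
  obtain ⟨s, hs, h⟩ := h
  refine ⟨s, hs, fun i => ?_⟩
  have h1 : ENNReal.ofReal ‖s‖ < ENNReal.ofReal c := by rwa [ofReal_norm]
  exact (norm_le_pi_norm s i).trans (ENNReal.ofReal_lt_ofReal_iff_of_nonneg (norm_nonneg _)|>.1 h1).le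

theorem residueNorm_le_of_bd {n : ℕ} {e : Fin n → T} {x : T} {c : ℝ} (h0 : 0 ≤ c)
    (h : Bd S e c x) : residueNorm S e x ≤ ENNReal.ofReal c := by
  obtain ⟨s, hs, hc⟩ := h
  refine (iInf₂_le s hs).trans ?_
  rw [← ofReal_norm]
  exact ENNReal.ofReal_le_ofReal ((pi_norm_le_iff_of_nonneg h0).2 hc)

theorem growthBd_of_spectralSeminorm_le {x : T} (h : spectralSeminorm S x ≤ 1) {r : ℝ}
    (hr : 1 < r) : GrowthBd S x r := by
  have h1 : spectralSeminorm S x < ENNReal.ofReal r := by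
    refine h.trans_lt ?_
    rw [← ENNReal.ofReal_one]
    exact (ENNReal.ofReal_lt_ofReal_iff (by linarith)).2 hr
  simp only [spectralSeminorm, iInf_lt_iff] at h1
  obtain ⟨n, e, h1⟩ := h1
  have h2 := (eventually_lt_of_limsup_lt h1).and (eventually_ge_atTop 1)
  obtain ⟨K, hK⟩ := eventually_atTop.1 h2
  refine ⟨Fin n ⊕ Fin K, inferInstance, Sum.elim e (fun i => x ^ (i : ℕ)), 1 + ‖(1 : S)‖,
    by positivity, fun k => ?_⟩
  have hrk : 1 ≤ r ^ k := one_le_pow₀ hr.le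
  rcases lt_or_ge k K with hk | hk
  · have := Bd.inr (e := e) (Bd.basis (S := S) (fun i : Fin K => x ^ (i : ℕ)) ⟨k, hk⟩)
      (norm_nonneg _)
    refine this.mono ?_
    nlinarith [norm_nonneg (1 : S)]
  · obtain ⟨h3, h4⟩ := hK k hk
    have hk0 : (0 : ℝ) < k := by exact_mod_cast h4
    rw [one_div, ENNReal.rpow_inv_lt_iff hk0, ENNReal.rpow_natCast,
      ← ENNReal.ofReal_pow (by linarith)] at h3
    refine ((bd_of_residueNorm_le h3).inl (by positivity)).mono ?_
    nlinarith [norm_nonneg (1 : S)]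

theorem spectralSeminorm_le_of_growthBd {x : T} (h : ∀ r : ℝ, 1 < r → GrowthBd S x r) :
    spectralSeminorm S x ≤ 1 := by
  refine le_of_forall_gt_imp_ge_of_dense fun b hb => ?_
  rcases eq_or_ne b ⊤ with rfl | hbt
  · exact le_top
  lift b to ℝ≥0 using hbt
  have hb : (1 : ℝ) < b := by exact_mod_cast hb
  obtain ⟨r, hr1, hrb⟩ := exists_between hb
  obtain ⟨ι, _, e, C, hC, hk⟩ := h r hr1
  let φ := Fintype.equivFin ι
  refine (iInf₂_le (Fintype.card ι) (e ∘ φ.symm)).trans ?_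
  refine limsup_le_of_le (by isBoundedDefault) ?_
  have hlim : Tendsto (fun k : ℕ => ((b : ℝ) / r) ^ k) atTop atTop :=
    tendsto_pow_atTop_atTop_of_one_lt ((one_lt_div (by linarith)).2 hrb)
  filter_upwards [hlim.eventually_ge_atTop C, eventually_ge_atTop 1] with k hkC hk1
  have hk0 : (0 : ℝ) < k := by exact_mod_cast hk1
  have hr0 : 0 < r ^ k := by positivity
  have hle : C * r ^ k ≤ (b : ℝ) ^ k := by
    rwa [div_pow, le_div_iff₀ hr0] at hkC
  rw [one_div, ENNReal.rpow_inv_le_iff hk0, ENNReal.rpow_natCast]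
  have hB : Bd S (e ∘ φ.symm) ((b : ℝ) ^ k) (x ^ k) := by
    obtain ⟨s, hs, hc⟩ := (hk k).mono hle
    refine ⟨s ∘ φ.symm, ?_, fun i => hc _⟩
    rw [← hs]
    exact Equiv.sum_comp φ.symm (fun i => s i • e i)
  refine (residueNorm_le_of_bd (by positivity) hB).trans (le_of_eq ?_)
  rw [ENNReal.ofReal_pow (by positivity), ENNReal.ofReal_coe_nnreal]

theorem GrowthBd.mul {x y : T} {r r' : ℝ} (hr : 0 ≤ r) (h : GrowthBd S x r)
    (h' : GrowthBd S y r') : GrowthBd S (x * y) (r * r') := by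
  obtain ⟨ι, _, e, C, hC, hk⟩ := h
  obtain ⟨κ, _, f, D, hD, hl⟩ := h'
  refine ⟨ι × κ, inferInstance, fun i => e i.1 * f i.2, C * D, by positivity, fun k => ?_⟩
  rw [mul_pow x y]
  exact ((hk k).mul (hl k) (by positivity)).mono (le_of_eq (by rw [mul_pow]; ring))

theorem GrowthBd.neg {x : T} {r : ℝ} (h : GrowthBd S x r) : GrowthBd S (-x) r := by
  obtain ⟨ι, _, e, C, hC, hk⟩ := h
  refine ⟨ι, inferInstance, e, C, hC, fun k => ?_⟩
  rw [neg_pow]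
  rcases neg_one_pow_eq_or T k with h | h
  · simpa [h] using hk k
  · simpa [h] using (hk k).neg

/-- If arbitrarily small coefficients suffice to write `1` in terms of a finite family generating a
subalgebra, then the algebra is zero. -/
theorem subsingleton_of_bd [CompleteSpace S] [Algebra.IsIntegral S T] {ι : Type} [Fintype ι]
    (e : ι → T) (h : ∀ c : ℝ, 0 < c → Bd S e c 1) : Subsingleton T := by
  classical
  let A : Subalgebra S T := Algebra.adjoin S (Set.range e)
  have hA : A.toSubmodule.FG := fg_adjoin_of_finite (Set.finite_range e)
    fun x _ => Algebra.IsIntegral.isIntegral x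
  obtain ⟨n, b, hb⟩ := Submodule.fg_iff_exists_fin_generating_family.1 hA
  have hmem : ∀ i j, e i * b j ∈ Submodule.span S (Set.range b) := fun i j => by
    rw [hb]
    exact A.mul_mem (Algebra.subset_adjoin ⟨i, rfl⟩)
      (hb ▸ Submodule.subset_span ⟨j, rfl⟩ : b j ∈ A.toSubmodule)
  choose a ha using fun i j => (Submodule.mem_span_range_iff_exists_fun S).1 (hmem i j)
  have hone : (1 : T) ∈ Submodule.span S (Set.range b) := by
    rw [hb]; exact A.one_mem
  have hcomp₀ : CompleteSpace (Matrix (Fin n) (Fin n) S) := inferInstance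
  let _ := Matrix.linftyOpNormedRing (n := Fin n) (α := S)
  have hcomp : @CompleteSpace (Matrix (Fin n) (Fin n) S) (PseudoMetricSpace.toUniformSpace) :=
    hcomp₀
  have : HasSummableGeomSeries (Matrix (Fin n) (Fin n) S) :=
    @instHasSummableGeomSeriesOfCompleteSpace _ _ hcomp
  let M : ι → Matrix (Fin n) (Fin n) S := fun i => Matrix.of fun j l => a i j l
  let D : ℝ := ∑ i, ‖M i‖
  have hD : 0 ≤ D := Finset.sum_nonneg fun _ _ => norm_nonneg _
  obtain ⟨s, hs, hc⟩ := h (1 / (D + 1)) (by positivity)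
  let N : Matrix (Fin n) (Fin n) S := ∑ i, Matrix.diagonal (fun _ => s i) * M i
  have hN : ‖N‖ < 1 := by
    have h1 : ‖N‖ ≤ 1 / (D + 1) * D := by
      refine (norm_sum_le _ _).trans ?_
      rw [Finset.mul_sum]
      refine Finset.sum_le_sum fun i _ => (norm_mul_le _ _).trans ?_
      refine mul_le_mul_of_nonneg_right ?_ (norm_nonneg _)
      rw [Matrix.linfty_opNorm_diagonal]
      exact (pi_norm_le_iff_of_nonneg (by positivity)).2 fun _ => hc i
    refine h1.trans_lt ?_
    rw [one_div, inv_mul_lt_iff₀ (by positivity)]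
    linarith
  have hNb : ((1 - N).map (algebraMap S T)).mulVec b = 0 := by
    funext j
    have h2 : ∑ l, N j l • b l = b j := by
      calc ∑ l, N j l • b l = ∑ l, ∑ i, (s i * a i j l) • b l := by
            refine Finset.sum_congr rfl fun l _ => ?_
            rw [← Finset.sum_smul]
            simp [N, M, Matrix.sum_apply, Matrix.diagonal_mul]
        _ = ∑ i, s i • ∑ l, a i j l • b l := by
            rw [Finset.sum_comm]
            simp only [Finset.smul_sum, mul_smul]
        _ = ∑ i, s i • (e i * b j) := by simp only [ha]
        _ = (∑ i, s i • e i) * b j := by simp only [Finset.sum_mul, smul_mul_assoc]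
        _ = b j := by rw [hs, one_mul]
    simp only [Matrix.mulVec, dotProduct, Matrix.map_apply, Matrix.sub_apply, map_sub, sub_mul,
      Finset.sum_sub_distrib, ← Algebra.smul_def, h2, Pi.zero_apply]
    simp [Matrix.one_apply]
  have hb0 : b = 0 := by
    have h3 : ((Units.oneSub N hN)⁻¹.val : Matrix (Fin n) (Fin n) S) * (1 - N) = 1 := by
      have := (Units.oneSub N hN).inv_mul
      rwa [Units.val_oneSub] at this
    have h4 := congrArg (fun X => (X.map (algebraMap S T)).mulVec b) h3
    simp only [Matrix.map_mul, ← Matrix.mulVec_mulVec, hNb, Matrix.mulVec_zero] at h4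
    rw [Matrix.map_one _ (map_zero _) (map_one _), Matrix.one_mulVec] at h4
    exact h4.symm
  have h10 : (1 : T) = 0 := by
    rw [hb0] at hone
    obtain ⟨c, hc⟩ := (Submodule.mem_span_range_iff_exists_fun S).1 hone
    simpa using hc.symm
  exact subsingleton_of_zero_eq_one h10.symm

variable [IsUltrametricDist S]

theorem Bd.add {ι : Type} [Fintype ι] {e : ι → T} {c : ℝ} {x y : T}
    (h : Bd S e c x) (h' : Bd S e c y) : Bd S e c (x + y) := by
  obtain ⟨s, hs, hc⟩ := h
  obtain ⟨t, ht, hd⟩ := h'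
  refine ⟨s + t, by simp [add_smul, Finset.sum_add_distrib, hs, ht], fun i => ?_⟩
  exact (IsUltrametricDist.norm_add_le_max _ _).trans (max_le (hc i) (hd i))

theorem Bd.sum {ι α : Type} [Fintype ι] {e : ι → T} {c : ℝ} (h0 : 0 ≤ c) (A : Finset α)
    (x : α → T) (h : ∀ a ∈ A, Bd S e c (x a)) : Bd S e c (∑ a ∈ A, x a) := by
  classical
  induction A using Finset.induction_on with
  | empty => simpa using Bd.zero e h0
  | insert a A ha ih =>
    rw [Finset.sum_insert ha]
    exact (h a (by simp)).add (ih fun b hb => h b (by simp [hb]))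

theorem Bd.nsmul {ι : Type} [Fintype ι] {e : ι → T} {c : ℝ} (h0 : 0 ≤ c) {x : T}
    (h : Bd S e c x) (m : ℕ) : Bd S e c (x * (m : T)) := by
  induction m with
  | zero => simpa using Bd.zero e h0
  | succ m ih =>
    rw [Nat.cast_succ, mul_add, mul_one]
    exact ih.add h

theorem GrowthBd.add {x y : T} {r : ℝ} (hr : 0 ≤ r) (h : GrowthBd S x r)
    (h' : GrowthBd S y r) : GrowthBd S (x + y) r := by
  obtain ⟨ι, _, e, C, hC, hk⟩ := h
  obtain ⟨κ, _, f, D, hD, hl⟩ := h'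
  refine ⟨ι × κ, inferInstance, fun i => e i.1 * f i.2, C * D, by positivity, fun k => ?_⟩
  rw [add_pow]
  refine Bd.sum (by positivity) _ _ fun m hm => Bd.nsmul (by positivity) ?_ _
  have hm' : m + (k - m) = k := by
    have := Finset.mem_range.1 hm
    omega
  refine ((hk m).mul (hl (k - m)) (by positivity)).mono (le_of_eq ?_)
  rw [mul_mul_mul_comm, ← pow_add, hm']

variable (S T) in
/-- The ring of integers `{x : v_sp(x) ≥ 0} = {x : |x|_sp ≤ 1}` of an `S`-algebra `T`. -/
noncomputable def integers : Subring T where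
  carrier := {x | spectralSeminorm S x ≤ 1}
  mul_mem' {x y} hx hy := spectralSeminorm_le_of_growthBd fun r hr => by
    have h1 : 1 < √r := by rwa [Real.lt_sqrt zero_le_one, one_pow]
    have := (growthBd_of_spectralSeminorm_le hx h1).mul (by positivity)
      (growthBd_of_spectralSeminorm_le hy h1)
    rwa [Real.mul_self_sqrt (by linarith)] at this
  one_mem' := spectralSeminorm_le_of_growthBd fun r hr =>
    ⟨Unit, inferInstance, fun _ => 1, ‖(1 : S)‖, norm_nonneg _, fun k => by
      rw [one_pow]
      exact (Bd.basis (S := S) (fun _ : Unit => (1 : T)) ()).mono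
        (le_mul_of_one_le_right (norm_nonneg _) (one_le_pow₀ hr.le))⟩
  add_mem' {x y} hx hy := spectralSeminorm_le_of_growthBd fun r hr =>
    (growthBd_of_spectralSeminorm_le hx hr).add (by linarith)
      (growthBd_of_spectralSeminorm_le hy hr)
  zero_mem' := spectralSeminorm_le_of_growthBd fun r hr =>
    ⟨Unit, inferInstance, fun _ => 1, ‖(1 : S)‖, norm_nonneg _, fun k => by
      rcases Nat.eq_zero_or_pos k with rfl | hk
      · simpa using Bd.basis (S := S) (fun _ : Unit => (1 : T)) ()
      · rw [zero_pow hk.ne']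
        exact Bd.zero _ (by positivity)⟩
  neg_mem' {x} hx := spectralSeminorm_le_of_growthBd fun r hr =>
    (growthBd_of_spectralSeminorm_le hx hr).neg


/-- The inverse of a topologically nilpotent scalar is never in the ring of integers. -/
theorem not_mul_eq_one [CompleteSpace S] [Algebra.IsIntegral S T] [Nontrivial T] (a : S)
    {ρ C : ℝ} (hρ0 : 0 ≤ ρ) (hρ : ρ < 1) (ha : ∀ k : ℕ, ‖a ^ k‖ ≤ ρ ^ k * C)
    (y : integers S T) : algebraMap S T a * y ≠ 1 := by
  intro hy
  obtain ⟨r, hr1, hr⟩ : ∃ r : ℝ, 1 < r ∧ ρ * r < 1 := by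
    refine ⟨2 / (1 + ρ), ?_, ?_⟩
    · rw [lt_div_iff₀ (by linarith)]; linarith
    · rw [mul_div_assoc', div_lt_one (by linarith)]; linarith
  obtain ⟨ι, _, e, D, hD, hk⟩ := growthBd_of_spectralSeminorm_le y.2 hr1
  have hC : 0 ≤ C := by simpa using (norm_nonneg _).trans (ha 0)
  refine not_subsingleton T (subsingleton_of_bd (S := S) e fun c hc => ?_)
  have hlim : Tendsto (fun k : ℕ => C * D * (ρ * r) ^ k) atTop (𝓝 (C * D * 0)) :=
    (tendsto_pow_atTop_nhds_zero_of_lt_one (by positivity) hr).const_mul _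
  rw [mul_zero] at hlim
  obtain ⟨k, hkc⟩ := (hlim.eventually_lt_const hc).exists
  have h1 : a ^ k • ((y : T) ^ k) = 1 := by
    rw [Algebra.smul_def, map_pow, ← mul_pow, hy, one_pow]
  have h2 := (hk k).smul (a ^ k)
  rw [h1] at h2
  refine h2.mono (le_trans ?_ hkc.le)
  calc ‖a ^ k‖ * (D * r ^ k) ≤ ρ ^ k * C * (D * r ^ k) :=
        mul_le_mul_of_nonneg_right (ha k) (by positivity)
    _ = C * D * (ρ * r) ^ k := by rw [mul_pow]; ring

end Spectral

/-! ### The completed ring of integers -/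

section Completion

variable (p : ℕ) [Fact p.Prime]
variable (S : Type u) [NormedCommRing S] [NormedAlgebra ℚ_[p] S] [IsUltrametricDist S]
variable (T : Type v) [CommRing T] [Algebra S T]

/-- The `p`-adic completion of the ring of integers of `T`. -/
abbrev OHat : Type v :=
  AdicCompletion (Ideal.span {(p : integers S T)}) (integers S T)

instance : IsAdicComplete (Ideal.span {(p : OHat p S T)}) (OHat p S T) := by
  have h := (IsAdicComplete.map_algebraMap_iff (S := OHat p S T) (M := OHat p S T)
    (Ideal.span {(p : integers S T)})).2
    (AdicCompletion.isAdicComplete (Submodule.fg_span (Set.finite_singleton _)))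
  rwa [Ideal.map_span, Set.image_singleton, map_natCast] at h

instance [CompleteSpace S] [Nontrivial S] [IsMaximalEtaleExtension S T] :
    Fact (¬ IsUnit (p : OHat p S T)) := by
  have := IsMaximalEtaleExtension.isIntegral S T
  have : Nontrivial T := (IsMaximalEtaleExtension.injective (S := S) (T := T)).nontrivial
  refine ⟨fun h => ?_⟩
  have h1 := h.map (AdicCompletion.evalOneₐ (Ideal.span {(p : integers S T)}))
  rw [map_natCast, ← map_natCast (Ideal.Quotient.mk (Ideal.span {(p : integers S T)})),
    Ideal.Quotient.eq_zero_iff_mem.2 (Ideal.mem_span_singleton_self _), isUnit_zero_iff,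
    ← map_one (Ideal.Quotient.mk _), eq_comm, Ideal.Quotient.eq_zero_iff_mem,
    Ideal.mem_span_singleton] at h1
  obtain ⟨y, hy⟩ := h1
  have hp : (1 : ℝ) < p := by exact_mod_cast (Fact.out : p.Prime).one_lt
  refine not_mul_eq_one (S := S) (T := T) (p : S) (ρ := (p : ℝ)⁻¹) (C := ‖(1 : S)‖)
    (by positivity) (inv_lt_one_of_one_lt₀ hp) (fun k => ?_) y ?_
  · rw [← map_natCast (algebraMap ℚ_[p] S), ← map_pow, norm_algebraMap, norm_pow,
      Padic.norm_p]
  · rw [map_natCast]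
    have := congrArg (Subring.subtype _) hy
    simpa using this.symm

end Completion

/-! ### Inverting `p`, and topologies -/

/-- The topology on a ring `Q`, given a ring homomorphism `f : R → Q`, for which the subgroups
`f (pᵐ R)` form a basis of neighbourhoods of `0`.  If `Q = R[1/p]` this is the Banach topology
with unit ball (the image of) `R`. -/
abbrev latticeTopology (p : ℕ) {R : Type*} {Q : Type*} [CommRing R] [CommRing Q] (f : R →+* Q) :
    TopologicalSpace Q where
  IsOpen U := ∀ x ∈ U, ∃ m : ℕ, ∀ y : R, x + f ((p : R) ^ m * y) ∈ U
  isOpen_univ _ _ := ⟨0, fun _ => trivial⟩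
  isOpen_inter U V hU hV x hx := by
    obtain ⟨m, hm⟩ := hU x hx.1
    obtain ⟨n, hn⟩ := hV x hx.2
    refine ⟨m + n, fun y => ⟨?_, ?_⟩⟩
    · rw [pow_add, mul_assoc]; exact hm _
    · rw [pow_add, mul_comm ((p : R) ^ m), mul_assoc]; exact hn _
  isOpen_sUnion s hs x hx := by
    obtain ⟨U, hU, hxU⟩ := hx
    obtain ⟨m, hm⟩ := hs U hU x hxU
    exact ⟨m, fun y => ⟨U, hU, hm y⟩⟩

/-- `R[1/p]`. -/
abbrev InvertP (p : ℕ) (R : Type*) [CommRing R] : Type _ := Localization.Away (p : R)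

/-- The topology on `R[1/p]` with unit ball the image of `R`. -/
instance InvertP.instTop (p : ℕ) (R : Type*) [CommRing R] : TopologicalSpace (InvertP p R) :=
  latticeTopology p (algebraMap R (InvertP p R))

/-! ### The ring `B_dR⁺` -/

section BdR

variable (R : Type u) [CommRing R] (p : ℕ) [Fact p.Prime]
  [Fact (¬ IsUnit (p : R))] [IsAdicComplete (Ideal.span {(p : R)}) R]

/-- `A_inf(R) = W(R♭)`, where `R♭` is the limit of `R/p` along the Frobenius. -/
abbrev AInf : Type u := WittVector p (PreTilt R p)

/-- The kernel of `θ : A_inf[1/p] → R[1/p]`. -/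
noncomputable abbrev kerTheta : Ideal (InvertP p (AInf R p)) :=
  RingHom.ker (fontaineThetaInvertP R p)

/-- The projection `B_dR⁺ → A_inf[1/p] / (Ker θ)ⁿ`. -/
noncomputable def BdRPlus.proj (n : ℕ) :
    BDeRhamPlus R p →+* InvertP p (AInf R p) ⧸ kerTheta R p ^ n :=
  (AdicCompletion.evalₐ (kerTheta R p) n).toRingHom

/-- The topology on `B_dR⁺`: the limit of the topologies of the rings `A_inf[1/p] / (Ker θ)ⁿ`,
where the unit ball of `A_inf[1/p] / (Ker θ)ⁿ` is the image of `A_inf`. -/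
noncomputable instance BdRPlus.instTop : TopologicalSpace (BDeRhamPlus R p) :=
  ⨅ n : ℕ, TopologicalSpace.induced (BdRPlus.proj R p n)
    (latticeTopology p ((Ideal.Quotient.mk (kerTheta R p ^ n)).comp
      (algebraMap (AInf R p) (InvertP p (AInf R p)))))

/-- The extension `θ : B_dR⁺ → R[1/p]` of Fontaine's map. -/
noncomputable def BdRPlus.theta : BDeRhamPlus R p →+* InvertP p R :=
  (Ideal.Quotient.lift (kerTheta R p ^ 1) (fontaineThetaInvertP R p)
    (fun a ha => by rwa [pow_one] at ha)).comp (BdRPlus.proj R p 1)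

end BdR

/-! ### Thickenings -/

/-- A thickening of a topological ring `Q`: a continuous surjective ring homomorphism
`B → Q` with nilpotent kernel. -/
structure IsThickening {B Q : Type*} [CommRing B] [TopologicalSpace B] [CommRing Q]
    [TopologicalSpace Q] (θB : B →+* Q) : Prop where
  continuous : Continuous θB
  surjective : Function.Surjective θB
  nilpotent : ∃ k : ℕ, RingHom.ker θB ^ (k + 1) = ⊥

end BdRThick

/-! Write `R` for the completed ring of integers. Integrally, `A_inf(R)` is the universal `p`-adic
thickening of `R`. If `A → R` is surjective with nilpotent kernel and `A` is `p`-adically complete,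
then `A` and `R` have the same tilt, because modulo `p` a power of Frobenius kills the kernel
(`tiltMap_bijective`). Fontaine's map for `A`, transported along this identification, lifts the one
for `R` (`exists_lift_fontaineTheta`). The lift is unique: Teichmüller elements have `p`-power
roots, and high `p`-powers erase first a nilpotent discrepancy modulo `p`, then a discrepancy
divisible by `p` (`wittVector_hom_ext_of_nilpotent_ker`).

A Banach thickening `B → R[1/p]` is reduced to this case by `exists_integral_thickening`: `B`
contains a bounded open, hence `p`-adically complete, subring that surjects onto `R` and contains
any prescribed bounded set of elements over `R`. The open mapping theorem gives bounded lifts of the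
elements of `R`; nilpotence of the kernel bounds all products of such lifts uniformly; the subring
consists of the multipliers over `R` of a lattice stable under these products.

A homomorphism from `A_inf[1/p]` to `B` is continuous exactly when it is bounded on `A_inf`. So the
integral lift extends continuously, kills a power of `Ker θ`, and factors through `B_dR⁺`;
uniqueness passes to `B_dR⁺` by density.

Two facts about `R` remain: `p` is a nonzerodivisor, so that `R` embeds in `R[1/p]`, and Frobenius
is surjective on `R/p`, which makes `θ` surjective. The second comes from solving the étale equation
`Y^(p²) = pY + x` in the maximal étale extension (`exists_pow_sub_dvd`). -/

namespace BdRThick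

universe u v

/-! ### Reduction modulo `p` along a nilpotent thickening -/

section ModP

variable {p : ℕ} {A R : Type*} [CommRing A] [CommRing R]

variable (p) in
/-- The map `A/p → R/p` induced by a ring homomorphism `A → R`. -/
def modPMap (φ : A →+* R) : ModP A p →+* ModP R p :=
  Ideal.quotientMap _ φ (by
    rw [Ideal.span_singleton_le_iff_mem, Ideal.mem_comap, map_natCast]
    exact Ideal.mem_span_singleton_self _)

@[simp] theorem modPMap_mk (φ : A →+* R) (a : A) :
    modPMap p φ (Ideal.Quotient.mk _ a) = Ideal.Quotient.mk _ (φ a) := rfl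

theorem modPMap_surjective {φ : A →+* R} (hφ : Function.Surjective φ) :
    Function.Surjective (modPMap p φ) := by
  intro y
  obtain ⟨y, rfl⟩ := Ideal.Quotient.mk_surjective y
  obtain ⟨a, rfl⟩ := hφ y
  exact ⟨Ideal.Quotient.mk _ a, rfl⟩

/-- By surjectivity, a representative can be corrected by a multiple of `p` so as to lie in the
kernel of `φ` itself, where nilpotence applies. -/
theorem pow_eq_zero_of_modPMap_eq_zero {φ : A →+* R} (hφ : Function.Surjective φ) {N : ℕ}
    (hN : RingHom.ker φ ^ N = ⊥) {a : ModP A p} (ha : modPMap p φ a = 0) : a ^ N = 0 := by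
  obtain ⟨a, rfl⟩ := Ideal.Quotient.mk_surjective a
  rw [modPMap_mk, Ideal.Quotient.eq_zero_iff_mem, Ideal.mem_span_singleton] at ha
  obtain ⟨c, hc⟩ := ha
  obtain ⟨c, rfl⟩ := hφ c
  have h1 : a - p * c ∈ RingHom.ker φ := by
    rw [RingHom.mem_ker, map_sub, map_mul, map_natCast, hc, sub_self]
  have h2 := Ideal.pow_mem_pow h1 N
  rw [hN, Ideal.mem_bot] at h2
  have h3 : Ideal.Quotient.mk (Ideal.span {(p : A)}) a = Ideal.Quotient.mk _ (a - p * c) := by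
    rw [Ideal.Quotient.eq]
    simp [Ideal.mem_span_singleton]
  rw [h3, ← map_pow, h2, map_zero]

end ModP

/-! ### Tilts, Witt vectors and integral thickenings -/

section PAdicRings

variable {p : ℕ} [Fact p.Prime]

/-- Two ring homomorphisms out of a ring of Witt vectors of a perfect ring into a `p`-adically
separated ring are equal if they agree on Teichmüller representatives modulo all powers of `p`. -/
theorem wittVector_hom_ext {k : Type*} [CommRing k] [CharP k p] [PerfectRing k p]
    {A : Type*} [CommRing A] [IsHausdorff (Ideal.span {(p : A)}) A]
    {f g : WittVector p k →+* A}
    (h : ∀ (n : ℕ) (x : k), (p : A) ^ n ∣ f (WittVector.teichmuller p x) -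
      g (WittVector.teichmuller p x)) : f = g := by
  have hn : ∀ n : ℕ, (Ideal.Quotient.mk (Ideal.span {(p : A)} ^ n)).comp f =
      (Ideal.Quotient.mk (Ideal.span {(p : A)} ^ n)).comp g := by
    intro n
    refine WittVector.eq_of_apply_teichmuller_eq _ _ ⟨n, ?_⟩ fun x => ?_
    · rw [← map_natCast (Ideal.Quotient.mk (Ideal.span {(p : A)} ^ n)), ← map_pow,
        Ideal.Quotient.eq_zero_iff_mem]
      exact Ideal.pow_mem_pow (Ideal.mem_span_singleton_self _) _
    · simp only [RingHom.comp_apply]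
      rw [Ideal.Quotient.eq, Ideal.span_singleton_pow, Ideal.mem_span_singleton]
      exact h n x
  ext1 x
  rw [IsHausdorff.eq_iff_smodEq (I := Ideal.span {(p : A)})]
  intro n
  rw [smul_eq_mul, Ideal.mul_top, SModEq.idealQuotientMk]
  exact congrArg (fun F => F x) (hn n)

/-- A ring homomorphism from Witt vectors of a perfect ring lifts in at most one way along a
homomorphism with nilpotent kernel. -/
theorem wittVector_hom_ext_of_nilpotent_ker {k : Type*} [CommRing k] [CharP k p] [PerfectRing k p]
    {A R : Type*} [CommRing A] [CommRing R] [IsHausdorff (Ideal.span {(p : A)}) A]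
    [Fact (¬ IsUnit (p : A))]
    (φ : A →+* R) {N : ℕ} (hN : RingHom.ker φ ^ N = ⊥)
    {f g : WittVector p k →+* A} (h : φ.comp f = φ.comp g) : f = g := by
  have hp1 : 1 < p := (Fact.out : p.Prime).one_lt
  have h1 : ∀ x : k, (p : A) ∣ f (WittVector.teichmuller p x) - g (WittVector.teichmuller p x) := by
    -- Take a `p^N`-th root: the values at `z` differ by an element of `ker φ`, whose `p^N`-th power
    -- vanishes since `N ≤ p^N`, and raising to `p^N` is additive modulo `p`.
    intro x
    obtain ⟨z, rfl⟩ : ∃ z : k, z ^ p ^ N = x := by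
      have := (bijective_iterateFrobenius k p N).surjective x
      simpa [iterateFrobenius_def] using this
    rw [← Ideal.mem_span_singleton, ← Ideal.Quotient.eq_zero_iff_mem]
    have h2 : (f (WittVector.teichmuller p z) - g (WittVector.teichmuller p z)) ^ p ^ N = 0 := by
      have h3 : f (WittVector.teichmuller p z) - g (WittVector.teichmuller p z)
          ∈ RingHom.ker φ := by
        rw [RingHom.mem_ker, map_sub, sub_eq_zero]
        exact congrArg (fun F => F (WittVector.teichmuller p z)) h
      refine pow_eq_zero_of_le (Nat.lt_pow_self hp1).le ?_
      have := Ideal.pow_mem_pow h3 N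
      rwa [hN] at this
    have h4 := congrArg (Ideal.Quotient.mk (Ideal.span {(p : A)})) h2
    have : CharP (A ⧸ Ideal.span {(p : A)}) p := inferInstanceAs (CharP (ModP A p) p)
    rw [map_pow, map_sub, sub_pow_char_pow, map_zero] at h4
    simpa using h4
  refine wittVector_hom_ext fun n x => ?_
  -- A congruence modulo `p` becomes one modulo `p^(n+1)` after raising to the `p^n`-th power.
  obtain ⟨z, rfl⟩ : ∃ z : k, z ^ p ^ n = x := by
    have := (bijective_iterateFrobenius k p n).surjective x
    simpa [iterateFrobenius_def] using this
  have := dvd_sub_pow_of_dvd_sub (h1 z) n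
  rw [map_pow, map_pow, map_pow]
  exact (pow_dvd_pow _ n.le_succ).trans this

variable {A R : Type*} [CommRing A] [CommRing R]

variable [Fact (¬ IsUnit (p : A))] [Fact (¬ IsUnit (p : R))]

variable (p) in
/-- The map of tilts induced by a ring homomorphism. -/
noncomputable def tiltMap (φ : A →+* R) : PreTilt A p →+* PreTilt R p :=
  Perfection.map p (modPMap p φ)

theorem coeff_tiltMap (φ : A →+* R) (x : PreTilt A p) (n : ℕ) :
    Perfection.coeff (ModP R p) p n (tiltMap p φ x) =
      modPMap p φ (Perfection.coeff (ModP A p) p n x) := rfl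

/-- Tilting does not see nilpotent kernels. -/
theorem tiltMap_bijective {φ : A →+* R} (hφ : Function.Surjective φ) {N : ℕ}
    (hN : RingHom.ker φ ^ N = ⊥) : Function.Bijective (tiltMap p φ) := by
  have hp1 : 1 < p := (Fact.out : p.Prime).one_lt
  -- The `N`-th iterate of Frobenius on `A/p` thus factors through `R/p`. Since coordinate `n` of a
  -- tilt element is the `p^N`-th power of coordinate `n + N`, this gives injectivity.
  have key : ∀ a b : ModP A p, modPMap p φ a = modPMap p φ b → a ^ p ^ N = b ^ p ^ N := by
    intro a b hab
    rw [← sub_eq_zero, ← sub_pow_char_pow]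
    exact pow_eq_zero_of_le (Nat.lt_pow_self hp1).le (pow_eq_zero_of_modPMap_eq_zero hφ hN
      (by rw [map_sub, hab, sub_self]))
  constructor
  · intro x y hxy
    refine Perfection.ext (p := p) (R := ModP A p) fun n => ?_
    have h1 := fun m => Perfection.coeffMonoidHom_pow_p_pow' (M := ModP A p) (p := p) m n N
    have h2 := congrArg (Perfection.coeff (ModP R p) p (n + N)) hxy
    rw [coeff_tiltMap, coeff_tiltMap] at h2
    exact (h1 x).symm.trans ((key _ _ h2).trans (h1 y))
  · intro y
    choose c hc using fun n => modPMap_surjective (p := p) hφ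
      (Perfection.coeff (ModP R p) p n y)
    -- The chosen lifts `c` need not be compatible under Frobenius; their `p^N`-th powers, shifted
    -- by `N`, are, by `key`.
    refine ⟨⟨fun n => c (n + N) ^ p ^ N, fun n => ?_⟩, ?_⟩
    · change (c (n + 1 + N) ^ p ^ N) ^ p = _
      rw [← pow_mul, mul_comm, pow_mul]
      refine key _ _ ?_
      rw [map_pow, hc, hc, add_right_comm]
      exact Perfection.coeff_pow_p' y (n + N)
    · refine Perfection.ext (p := p) (R := ModP R p) fun n => ?_
      change modPMap p φ (c (n + N) ^ p ^ N) = _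
      rw [map_pow, hc]
      exact Perfection.coeffMonoidHom_pow_p_pow' (M := ModP R p) (p := p) y n N

variable [IsAdicComplete (Ideal.span {(p : A)}) A] [IsAdicComplete (Ideal.span {(p : R)}) R]

/-- The untilt is characterised by congruences, modulo growing powers of `p`, with `p^n`-th powers
of lifts of the coordinates, and ring homomorphisms preserve these. -/
theorem map_untilt (φ : A →+* R) (x : PreTilt A p) :
    φ x.untilt = (tiltMap p φ x).untilt := by
  refine (Perfection.teichmuller_spec fun n => ?_).symm
  obtain ⟨y, hy⟩ := Ideal.Quotient.mk_surjective (Perfection.coeff (ModP A p) p n x)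
  refine ⟨φ y, ?_, ?_⟩
  · have := congrArg (modPMap p φ) hy
    rwa [modPMap_mk] at this
  · have h1 := (Perfection.teichmuller_sModEq hy).symm
    rw [SModEq.idealQuotientMk, Ideal.Quotient.eq, Ideal.span_singleton_pow,
      Ideal.mem_span_singleton] at h1 ⊢
    have := map_dvd φ h1
    simp only [map_pow, map_natCast, map_sub] at this
    exact this

theorem comp_fontaineTheta (φ : A →+* R) :
    φ.comp (WittVector.fontaineTheta A p) =
      (WittVector.fontaineTheta R p).comp (WittVector.map (tiltMap p φ)) := by
  refine wittVector_hom_ext fun n x => ?_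
  rw [RingHom.comp_apply, RingHom.comp_apply, WittVector.fontaineTheta_teichmuller,
    WittVector.map_teichmuller, WittVector.fontaineTheta_teichmuller, map_untilt, sub_self]
  exact dvd_zero _

/-- `A_inf(R)` is the universal `p`-adic thickening of `R`: existence. -/
theorem exists_lift_fontaineTheta {φ : A →+* R} (hφ : Function.Surjective φ) {N : ℕ}
    (hN : RingHom.ker φ ^ N = ⊥) :
    ∃ f : AInf R p →+* A, φ.comp f = WittVector.fontaineTheta R p := by
  -- The lift is Fontaine's map for `A`, precomposed with the inverse identification of tilts;
  -- naturality makes it lie over the one for `R`.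
  let e := RingEquiv.ofBijective (tiltMap p φ) (tiltMap_bijective hφ hN)
  refine ⟨(WittVector.fontaineTheta A p).comp (WittVector.map (e.symm : PreTilt R p →+* _)), ?_⟩
  rw [← RingHom.comp_assoc, comp_fontaineTheta]
  ext1 x
  simp only [RingHom.comp_apply]
  congr 1
  ext n
  rw [WittVector.map_coeff, WittVector.map_coeff]
  exact e.apply_symm_apply _

end PAdicRings

/-! ### The lattice topology -/

section Lattice

theorem mem_nhds_latticeTopology {p : ℕ} {R Q : Type*} [CommRing R] [CommRing Q] {f : R →+* Q}
    {x : Q} {U : Set Q} :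
    U ∈ @nhds Q (latticeTopology p f) x ↔ ∃ m : ℕ, ∀ y : R, x + f ((p : R) ^ m * y) ∈ U := by
  let _ := latticeTopology p f
  rw [mem_nhds_iff]
  constructor
  · rintro ⟨V, hVU, hV, hx⟩
    obtain ⟨m, hm⟩ := hV x hx
    exact ⟨m, fun y => hVU (hm y)⟩
  · rintro ⟨m, hm⟩
    refine ⟨Set.range fun y => x + f ((p : R) ^ m * y), ?_, ?_, 0, by simp⟩
    · rintro _ ⟨y, rfl⟩
      exact hm y
    · rintro _ ⟨y, rfl⟩
      exact ⟨m, fun z => ⟨y + z, by simp only [mul_add, map_add, add_assoc]⟩⟩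

/-- Ring homomorphisms commute with multiplication by `p^m`, so it is enough to control the unit
ball. -/
theorem continuous_latticeTopology {p : ℕ} {R Q R' Q' : Type*} [CommRing R] [CommRing Q]
    [CommRing R'] [CommRing Q'] {f : R →+* Q} {f' : R' →+* Q'} (F : Q →+* Q')
    (h : ∀ y, F (f y) ∈ f'.range) :
    @Continuous _ _ (latticeTopology p f) (latticeTopology p f') F := by
  let _ := latticeTopology p f
  let _ := latticeTopology p f'
  refine continuous_iff_continuousAt.2 fun x U hU => ?_
  obtain ⟨m, hm⟩ := mem_nhds_latticeTopology.1 hU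
  refine mem_nhds_latticeTopology.2 ⟨m, fun y => ?_⟩
  obtain ⟨z, hz⟩ := h y
  have := hm z
  rwa [map_mul, hz, map_pow, map_natCast, ← map_natCast F, ← map_natCast f, ← map_pow, ← map_pow,
    ← map_mul, ← map_mul, ← map_add] at this

theorem exists_ball_of_continuous {p : ℕ} {R Q : Type*} [CommRing R] [CommRing Q] {f : R →+* Q}
    {B : Type*} [NormedCommRing B] {θ : B →+* Q}
    (hθ : @Continuous _ _ _ (latticeTopology p f) θ) (m : ℕ) :
    ∃ δ > 0, ∀ b, ‖b‖ ≤ δ → ∃ y, f ((p : R) ^ m * y) = θ b := by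
  let _ := latticeTopology p f
  have h1 : θ ⁻¹' (Set.range fun y => f ((p : R) ^ m * y)) ∈ 𝓝 (0 : B) := by
    refine hθ.continuousAt ?_
    rw [map_zero]
    exact mem_nhds_latticeTopology.2 ⟨m, fun y => ⟨y, by simp⟩⟩
  obtain ⟨δ, hδ, h2⟩ := Metric.nhds_basis_closedBall.mem_iff.1 h1
  exact ⟨δ, hδ, fun b hb => h2 (by simpa using hb)⟩

variable {p : ℕ} [Fact p.Prime] {R Q : Type*} [CommRing R] [CommRing Q] {f : R →+* Q}
  {B : Type*} [NormedCommRing B] [NormedAlgebra ℚ_[p] B]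

/-- An equality although the norm of `B` is only submultiplicative: `p^m` acts as a scalar of
`ℚ_[p]`. -/
theorem norm_natCast_pow_mul (m : ℕ) (b : B) : ‖(p : B) ^ m * b‖ = ((p : ℝ)⁻¹) ^ m * ‖b‖ := by
  have : (p : B) ^ m * b = ((p : ℚ_[p]) ^ m) • b := by
    rw [Algebra.smul_def, map_pow, map_natCast]
  rw [this, norm_smul, norm_pow, Padic.norm_p]

theorem exists_natCast_pow_mul_eq (m : ℕ) (b : B) :
    ∃ c : B, (p : B) ^ m * c = b ∧ ‖c‖ = (p : ℝ) ^ m * ‖b‖ := by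
  have hp : (p : ℚ_[p]) ≠ 0 := Nat.cast_ne_zero.2 (Fact.out : p.Prime).ne_zero
  have h : (p : B) ^ m * (((p : ℚ_[p]) ^ m)⁻¹ • b) = b := by
    have h1 : (p : B) ^ m = algebraMap ℚ_[p] B ((p : ℚ_[p]) ^ m) := by
      rw [map_pow, map_natCast]
    rw [h1, ← Algebra.smul_def, smul_smul, mul_inv_cancel₀ (pow_ne_zero _ hp), one_smul]
  refine ⟨_, h, ?_⟩
  have := norm_natCast_pow_mul (p := p) m (((p : ℚ_[p]) ^ m)⁻¹ • b)
  have hp' : (p : ℝ) ≠ 0 := Nat.cast_ne_zero.2 (Fact.out : p.Prime).ne_zero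
  rw [h] at this
  rw [this, inv_pow, mul_inv_cancel_left₀ (pow_ne_zero _ hp')]

theorem tendsto_inv_pow_mul (C : ℝ) :
    Tendsto (fun m : ℕ => ((p : ℝ)⁻¹) ^ m * C) atTop (𝓝 0) := by
  have hp : (1 : ℝ) < p := by exact_mod_cast (Fact.out : p.Prime).one_lt
  simpa using (tendsto_pow_atTop_nhds_zero_of_lt_one (by positivity)
    (inv_lt_one_of_one_lt₀ hp)).mul_const C

theorem continuous_of_bounded (F : Q →+* B) {C : ℝ} (h : ∀ y, ‖F (f y)‖ ≤ C) :
    @Continuous _ _ (latticeTopology p f) _ F := by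
  let _ := latticeTopology p f
  refine continuous_iff_continuousAt.2 fun x => ?_
  rw [ContinuousAt, Metric.nhds_basis_ball.tendsto_right_iff]
  intro ε hε
  obtain ⟨m, hm⟩ := ((tendsto_inv_pow_mul (p := p) C).eventually_lt_const hε).exists
  refine mem_nhds_latticeTopology.2 ⟨m, fun y => ?_⟩
  simp only [Set.mem_ofPred_eq, Metric.mem_ball, dist_eq_norm, map_add, add_sub_cancel_left,
    map_mul, map_pow, map_natCast, norm_natCast_pow_mul]
  exact (mul_le_mul_of_nonneg_left (h y) (by positivity)).trans_lt hm

/-- Some `f (p^m R)` lands in the open unit ball of `B`; dividing by `p^m` gives the bound `p^m`. -/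
theorem exists_bound_of_continuous {F : Q →+* B}
    (hF : @Continuous _ _ (latticeTopology p f) _ F) : ∃ C, ∀ y, ‖F (f y)‖ ≤ C := by
  let _ := latticeTopology p f
  have h1 : F ⁻¹' Metric.ball 0 1 ∈ 𝓝 (0 : Q) := by
    refine hF.continuousAt ?_
    rw [map_zero]
    exact Metric.ball_mem_nhds _ one_pos
  obtain ⟨m, hm⟩ := mem_nhds_latticeTopology.1 h1
  refine ⟨(p : ℝ) ^ m, fun y => ?_⟩
  have h2 := hm y
  have hp : (0 : ℝ) < p := by exact_mod_cast (Fact.out : p.Prime).pos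
  simp only [zero_add, Set.mem_preimage, Metric.mem_ball, dist_zero_right, map_mul, map_pow,
    map_natCast, norm_natCast_pow_mul] at h2
  rw [inv_pow, inv_mul_lt_iff₀ (by positivity), mul_one] at h2
  exact h2.le

end Lattice

/-! ### The open mapping theorem -/

section OpenMapping

/-- A `p`-adically complete ring is a Baire space: if it is a union of a sequence of subgroups, the
closure of one of them is open. -/
theorem exists_addSubgroup_closure_open {p : ℕ} {R : Type*} [CommRing R]
    [IsAdicComplete (Ideal.span {(p : R)}) R] (H : ℕ → AddSubgroup R) (hH : ∀ x, ∃ n, x ∈ H n) :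
    ∃ n c : ℕ, ∀ (c' : ℕ) (x : R), ∃ h ∈ H n, ∃ y, (p : R) ^ c * x = h + (p : R) ^ c' * y := by
  by_contra! hcon
  -- A pair `(x, c)` stands for the ball `x + p^c R`. Each ball contains a strictly smaller one
  -- disjoint from `H n`: if the centre is outside the closure of `H n`, shrink; otherwise first
  -- move the centre by a `p^c x'` outside that closure, which works because `H n` is a subgroup.
  have step : ∀ (n : ℕ) (z : R × ℕ), ∃ w : R × ℕ, z.2 < w.2 ∧ (p : R) ^ z.2 ∣ w.1 - z.1 ∧
      ∀ h ∈ H n, ∀ y, w.1 ≠ h + (p : R) ^ w.2 * y := by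
    rintro n ⟨x, c⟩
    by_cases hx : ∃ c'', ∀ h ∈ H n, ∀ y, x ≠ h + (p : R) ^ c'' * y
    · obtain ⟨c'', hc⟩ := hx
      refine ⟨(x, c'' + (c + 1)), by simp; omega, by simp, fun h hh y => ?_⟩
      have := hc h hh ((p : R) ^ (c + 1) * y)
      rwa [← mul_assoc, ← pow_add] at this
    · push Not at hx
      obtain ⟨c', x', h'⟩ := hcon n c
      refine ⟨(x + (p : R) ^ c * x', c' + (c + 1)), by simp; omega, by simp, fun h hh y he => ?_⟩
      obtain ⟨h2, hh2, y2, he2⟩ := hx (c' + (c + 1))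
      refine h' (h - h2) ((H n).sub_mem hh hh2) ((p : R) ^ (c + 1) * (y - y2)) ?_
      rw [← mul_assoc, ← pow_add]
      dsimp only at he
      linear_combination he - he2
  choose nxt hlt hdvd hne using step
  let z : ℕ → R × ℕ := fun n => Nat.rec (0, 0) nxt n
  have hz : ∀ n, z (n + 1) = nxt n (z n) := fun _ => rfl
  have hmono : StrictMono fun n => (z n).2 := strictMono_nat_of_lt_succ fun n => by
    rw [hz]; exact hlt _ _
  have hd : ∀ m n, m ≤ n → (p : R) ^ (z m).2 ∣ (z n).1 - (z m).1 := by
    intro m n hmn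
    induction n, hmn using Nat.le_induction with
    | base => simp
    | succ n hmn ih =>
      have h1 := (pow_dvd_pow (p : R) (hmono.monotone hmn)).trans (hdvd n (z n))
      have := dvd_add h1 ih
      rwa [sub_add_sub_cancel, ← hz] at this
  obtain ⟨L, hL⟩ := IsPrecomplete.prec (I := Ideal.span {(p : R)}) inferInstance
    (f := fun n => (z n).1) (fun {m n} hmn => by
      rw [smul_eq_mul, Ideal.mul_top, SModEq.comm, SModEq.sub_mem, Ideal.span_singleton_pow,
        Ideal.mem_span_singleton]
      exact (pow_dvd_pow _ (hmono.le_apply)).trans (hd m n hmn))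
  simp only [smul_eq_mul, Ideal.mul_top, SModEq.sub_mem, Ideal.span_singleton_pow,
        Ideal.mem_span_singleton] at hL
  obtain ⟨n, hn⟩ := hH L
  -- The limit of the centres lies in every ball, hence in no `H n`. Convergence is read at the
  -- index given by the exponent of ball `n + 1`, which is at least `n + 1`.
  have h1 : (p : R) ^ (z (n + 1)).2 ∣ (z (n + 1)).1 - L := by
    have h2 := dvd_sub (hL (z (n + 1)).2) (hd (n + 1) _ hmono.le_apply)
    rw [sub_sub_sub_cancel_left] at h2
    exact h2
  obtain ⟨y, hy⟩ := h1
  exact hne n (z n) L hn y (by rw [← hz, ← hy, add_sub_cancel])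

variable {p : ℕ} [Fact p.Prime] {R Q : Type*} [CommRing R] [CommRing Q] {f : R →+* Q}
  {B : Type*} [NormedCommRing B] [NormedAlgebra ℚ_[p] B] [IsUltrametricDist B] [CompleteSpace B]

/-- The open mapping theorem for a continuous surjection from a Banach algebra. -/
theorem exists_bounded_lift [IsAdicComplete (Ideal.span {(p : R)}) R]
    (hf : Function.Injective f) {θ : B →+* Q}
    (hθ : @Continuous _ _ _ (latticeTopology p f) θ) (hs : Function.Surjective θ) :
    ∃ M : ℝ, ∀ x : R, ∃ b, θ b = f x ∧ ‖b‖ ≤ M := by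
  let H : ℕ → AddSubgroup R := fun n =>
    { carrier := {x | ∃ b, θ b = f x ∧ ‖b‖ ≤ n}
      add_mem' := by
        rintro x y ⟨b, hb, hbn⟩ ⟨c, hc, hcn⟩
        exact ⟨b + c, by simp [hb, hc],
          (IsUltrametricDist.norm_add_le_max _ _).trans (max_le hbn hcn)⟩
      zero_mem' := ⟨0, by simp, by simp⟩
      neg_mem' := by
        rintro x ⟨b, hb, hbn⟩
        exact ⟨-b, by simp [hb], by simpa using hbn⟩ }
  -- Surjectivity of `θ` says that the subgroups of elements with a preimage of norm at most `n`
  -- cover `R`.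
  obtain ⟨n, c, hnc⟩ := exists_addSubgroup_closure_open (p := p) H fun x => by
    obtain ⟨b, hb⟩ := hs (f x)
    obtain ⟨n, hn⟩ := exists_nat_ge ‖b‖
    exact ⟨n, b, hb, hn⟩
  replace hnc : ∀ x : R, ∃ (b : B) (y : R), ‖b‖ ≤ n ∧
      f ((p : R) ^ c * x) = θ b + f ((p : R) ^ (c + 1) * y) := by
    intro x
    obtain ⟨h, ⟨b, hb, hbn⟩, y, hy⟩ := hnc (c + 1) x
    exact ⟨b, y, hbn, by rw [hy, map_add, hb]⟩
  choose b y hb hy using hnc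
  refine ⟨(p : ℝ) ^ c * n, fun x => ?_⟩
  -- With `c' = c + 1` the remainder `p^(c+1) y` is `p` times an element of the same shape, so the
  -- approximation iterates and the corrections form a geometrically convergent series.
  let a : ℕ → B := fun i => (p : B) ^ i * b (y^[i] x)
  have ha : ∀ i, ‖a i‖ ≤ ((p : ℝ)⁻¹) ^ i * n := fun i => by
    rw [norm_natCast_pow_mul]
    exact mul_le_mul_of_nonneg_left (hb _) (by positivity)
  have hp : (1 : ℝ) < p := by exact_mod_cast (Fact.out : p.Prime).one_lt
  have hp1 : (p : ℝ)⁻¹ < 1 := inv_lt_one_of_one_lt₀ hp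
  have hsum : Summable a := Summable.of_norm_bounded
    ((summable_geometric_of_lt_one (by positivity) hp1).mul_right _) ha
  have hlim := hsum.hasSum.tendsto_sum_nat
  have hpart : ∀ m, f ((p : R) ^ c * x) =
      θ (∑ i ∈ Finset.range m, a i) + f ((p : R) ^ (m + c) * y^[m] x) := by
    intro m
    induction m with
    | zero => simp
    | succ m ih =>
      rw [ih, pow_add, mul_assoc, map_mul f, hy, Finset.sum_range_succ, map_add,
        Function.iterate_succ_apply']
      simp only [a, map_mul, map_pow, map_natCast]
      ring
  have hnorm : ‖∑' i, a i‖ ≤ n := by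
    refine le_of_tendsto hlim.norm (Eventually.of_forall fun m => ?_)
    refine IsUltrametricDist.norm_sum_le_of_forall_le_of_nonneg (by positivity) fun i _ => ?_
    exact (ha i).trans (mul_le_of_le_one_left (by positivity) (pow_le_one₀ (by positivity) hp1.le))
  have happrox : ∀ m : ℕ, ∃ z, f ((p : R) ^ m * z) = θ (∑' i, a i) - f ((p : R) ^ c * x) := by
    intro m
    obtain ⟨δ, hδ, hδ'⟩ := exists_ball_of_continuous hθ m
    obtain ⟨N, hN, hmN⟩ := ((Metric.tendsto_nhds.1 hlim δ hδ).and
      (eventually_ge_atTop m)).exists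
    obtain ⟨z, hz⟩ := hδ' (∑' i, a i - ∑ i ∈ Finset.range N, a i) (by
      rw [← dist_eq_norm, dist_comm]; exact hN.le)
    obtain ⟨d, rfl⟩ := Nat.exists_eq_add_of_le hmN
    refine ⟨z - (p : R) ^ (d + c) * y^[m + d] x, ?_⟩
    rw [mul_sub, map_sub, hz, hpart (m + d), map_sub, ← mul_assoc, ← pow_add, ← add_assoc]
    ring
  -- The error lies in `f (p^m R)` for every `m`; injectivity of `f` and separatedness of `R` force
  -- it to vanish.
  have hzero : θ (∑' i, a i) - f ((p : R) ^ c * x) = 0 := by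
    obtain ⟨z, hz⟩ := happrox 0
    rw [pow_zero, one_mul] at hz
    rw [← hz]
    suffices z = 0 by rw [this, map_zero]
    rw [IsHausdorff.eq_iff_smodEq (I := Ideal.span {(p : R)})]
    intro m
    rw [smul_eq_mul, Ideal.mul_top, SModEq.sub_mem, Ideal.span_singleton_pow,
      Ideal.mem_span_singleton, sub_zero]
    obtain ⟨w, hw⟩ := happrox m
    exact ⟨w, hf (hz.trans hw.symm)⟩
  obtain ⟨s, hs1, hs2⟩ := exists_natCast_pow_mul_eq (p := p) c (∑' i, a i)
  refine ⟨s, ?_, ?_⟩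
  · have h1 : IsUnit ((p : Q) ^ c) := by
      rw [← map_natCast θ, ← map_natCast (algebraMap ℚ_[p] B)]
      exact (((Nat.cast_ne_zero.2 (Fact.out : p.Prime).ne_zero).isUnit.map _).map θ).pow c
    refine h1.mul_left_cancel ?_
    have h2 := congrArg θ hs1
    rw [map_mul, map_pow, map_natCast, sub_eq_zero.1 hzero, map_mul, map_pow, map_natCast] at h2
    exact h2
  · rw [hs2]
    exact mul_le_mul_of_nonneg_left hnorm (by positivity)

end OpenMapping

/-! ### Bounded subrings of thickenings -/

section Bounded

variable {Q : Type*} [CommRing Q] {B : Type*} [NormedCommRing B] [IsUltrametricDist B]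

/-- Lifts of bounded norm of elements of a subring are uniformly power-bounded, if the kernel is
nilpotent. -/
theorem exists_bound_mul_prod (θ : B →+* Q) (R : Subring Q) {M : ℝ} (hM0 : 0 ≤ M)
    (hM1 : ‖(1 : B)‖ ≤ M) (hM : ∀ x ∈ R, ∃ b, θ b = x ∧ ‖b‖ ≤ M) (i j : ℕ)
    (hij : RingHom.ker θ ^ (i + j) = ⊥) :
    ∃ C, 0 ≤ C ∧ ∀ d ∈ RingHom.ker θ ^ j, ∀ l : List B, (∀ b ∈ l, θ b ∈ R ∧ ‖b‖ ≤ M) →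
      ‖d * l.prod‖ ≤ ‖d‖ * C := by
  induction i generalizing j with
  | zero =>
    refine ⟨0, le_rfl, fun d hd l _ => ?_⟩
    rw [zero_add] at hij
    rw [hij, Ideal.mem_bot] at hd
    simp [hd]
  | succ i ih =>
    obtain ⟨C, hC, h⟩ := ih (j + 1) (by rwa [add_right_comm] at hij)
    -- `M` bounds the main term; `max (M * M) M` bounds the error of one replacement, and `C` comes
    -- from the next power of the kernel.
    refine ⟨max M ((max (M * M) M) * C), le_max_of_le_left hM0, ?_⟩
    have key : ∀ l : List B, (∀ b ∈ l, θ b ∈ R ∧ ‖b‖ ≤ M) → ∀ r, θ r ∈ R → ‖r‖ ≤ M →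
        ∀ d ∈ RingHom.ker θ ^ j,
        ‖d * (r * l.prod)‖ ≤ ‖d‖ * max M ((max (M * M) M) * C) := by
      intro l
      induction l with
      | nil =>
        intro _ r _ hr d _
        rw [List.prod_nil, mul_one]
        exact (norm_mul_le _ _).trans
          (mul_le_mul_of_nonneg_left (hr.trans (le_max_left _ _)) (norm_nonneg _))
      | cons x l ihl =>
        intro hl r hr hrM d hd
        rw [List.forall_mem_cons] at hl
        obtain ⟨s, hs, hsM⟩ := hM (θ (r * x)) (by rw [map_mul]; exact R.mul_mem hr hl.1.1)
        have hδ : r * x - s ∈ RingHom.ker θ := by rw [RingHom.mem_ker, map_sub, hs, sub_self]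
        have hδn : ‖r * x - s‖ ≤ max (M * M) M :=
          (by simpa [sub_eq_add_neg] using IsUltrametricDist.norm_add_le_max (r * x) (-s) :
            ‖r * x - s‖ ≤ max ‖r * x‖ ‖s‖).trans (max_le_max
            ((norm_mul_le _ _).trans (mul_le_mul hrM hl.1.2 (norm_nonneg _) hM0)) hsM)
        -- The accumulator `r` absorbs `x` and is replaced by a lift `s` of `θ (r * x)`, again of
        -- norm at most `M`. The error gains a factor in the kernel, so the induction on `i` handles
        -- it; by the ultrametric inequality errors do not accumulate.
        have heq : d * (r * (x :: l).prod) = d * (s * l.prod) + d * (r * x - s) * l.prod := by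
          rw [List.prod_cons]; ring
        rw [heq]
        refine (IsUltrametricDist.norm_add_le_max _ _).trans (max_le ?_ ?_)
        · exact ihl hl.2 s (by rw [hs, map_mul]; exact R.mul_mem hr hl.1.1) hsM d hd
        · refine (h _ (by rw [pow_succ]; exact Ideal.mul_mem_mul hd hδ) l hl.2).trans ?_
          refine le_trans ?_ (mul_le_mul_of_nonneg_left (le_max_right _ _) (norm_nonneg _))
          rw [← mul_assoc]
          exact mul_le_mul_of_nonneg_right ((norm_mul_le _ _).trans
            (mul_le_mul_of_nonneg_left hδn (norm_nonneg _))) hC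
    intro d hd l hl
    have := key l hl 1 (by rw [map_one]; exact R.one_mem) hM1 d hd
    rwa [one_mul] at this

/-- The elements of `B` that lie over `R` and preserve the lattice
`{x : ‖x g‖ ≤ 1 for all g ∈ P}`. -/
def multiplierRing (θ : B →+* Q) (R : Subring Q) (P : Submonoid B) : Subring B where
  carrier := {b | θ b ∈ R ∧ ∀ x, (∀ g ∈ P, ‖x * g‖ ≤ 1) → ∀ g ∈ P, ‖b * x * g‖ ≤ 1}
  mul_mem' {a b} ha hb := ⟨by rw [map_mul]; exact R.mul_mem ha.1 hb.1, fun x hx g hg => by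
    rw [mul_assoc a b x]; exact ha.2 _ (hb.2 x hx) g hg⟩
  one_mem' := ⟨by rw [map_one]; exact R.one_mem, fun x hx => by simpa using hx⟩
  add_mem' {a b} ha hb := ⟨by rw [map_add]; exact R.add_mem ha.1 hb.1, fun x hx g hg => by
    rw [add_mul, add_mul]
    exact (IsUltrametricDist.norm_add_le_max _ _).trans (max_le (ha.2 x hx g hg) (hb.2 x hx g hg))⟩
  zero_mem' := ⟨by rw [map_zero]; exact R.zero_mem, fun x _ g _ => by simp⟩
  neg_mem' {a} ha := ⟨by rw [map_neg]; exact R.neg_mem ha.1, fun x hx g hg => by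
    rw [neg_mul, neg_mul, norm_neg]; exact ha.2 x hx g hg⟩

/-- Multiplying by an element of `P` only permits fewer test elements `g`, so `P` preserves the
lattice. -/
theorem mem_multiplierRing {θ : B →+* Q} {R : Subring Q} {P : Submonoid B} {b : B}
    (hb : θ b ∈ R) (hP : b ∈ P) : b ∈ multiplierRing θ R P :=
  ⟨hb, fun x hx g hg => by rw [mul_comm b x, mul_assoc]; exact hx _ (P.mul_mem hP hg)⟩

theorem exists_ball_subset_multiplierRing {θ : B →+* Q} {R : Subring Q} {P : Submonoid B}
    {C δ : ℝ} (hC : ∀ g ∈ P, ‖g‖ ≤ C) (hδ : 0 < δ) (hR : ∀ b, ‖b‖ ≤ δ → θ b ∈ R) :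
    ∃ ε > 0, ∀ b, ‖b‖ ≤ ε → b ∈ multiplierRing θ R P := by
  have hC0 : 0 ≤ C := (norm_nonneg _).trans (hC 1 P.one_mem)
  -- The lattice lies in the unit ball because `1 ∈ P`; `C + 1` avoids division by zero.
  refine ⟨min δ (1 / (C + 1)), by positivity, fun b hb => ⟨hR b (hb.trans (min_le_left _ _)),
    fun x hx g hg => ?_⟩⟩
  have hx1 : ‖x‖ ≤ 1 := by simpa using hx 1 P.one_mem
  have hb1 : ‖b‖ ≤ 1 / (C + 1) := hb.trans (min_le_right _ _)
  have h1 : ‖b * x‖ ≤ 1 / (C + 1) :=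
    (norm_mul_le _ _).trans ((mul_le_of_le_one_right (norm_nonneg _) hx1).trans hb1)
  calc ‖b * x * g‖ ≤ ‖b * x‖ * ‖g‖ := norm_mul_le _ _
    _ ≤ 1 / (C + 1) * (C + 1) :=
      mul_le_mul h1 ((hC g hg).trans (by linarith)) (norm_nonneg _) (by positivity)
    _ = 1 := by field_simp

/-- Since `P` is bounded, the lattice contains some `p^m`; a multiplier must send it into the unit
ball. -/
theorem exists_bound_multiplierRing (p : ℕ) [Fact p.Prime] [NormedAlgebra ℚ_[p] B]
    {θ : B →+* Q} {R : Subring Q} {P : Submonoid B}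
    {C : ℝ} (hC : ∀ g ∈ P, ‖g‖ ≤ C) : ∃ D, ∀ b ∈ multiplierRing θ R P, ‖b‖ ≤ D := by
  obtain ⟨m, hm⟩ := ((tendsto_inv_pow_mul (p := p) C).eventually_lt_const one_pos).exists
  refine ⟨(p : ℝ) ^ m, fun b hb => ?_⟩
  have h1 := hb.2 ((p : B) ^ m) (fun g hg => by
    rw [norm_natCast_pow_mul]
    exact (mul_le_mul_of_nonneg_left (hC g hg) (by positivity)).trans hm.le) 1 P.one_mem
  have hp : (0 : ℝ) < p := by exact_mod_cast (Fact.out : p.Prime).pos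
  rwa [mul_one, mul_comm, norm_natCast_pow_mul, inv_pow, inv_mul_le_iff₀ (by positivity),
    mul_one] at h1

/-- A bounded open subring of a Banach algebra is `p`-adically complete. -/
theorem isAdicComplete_of_bounded_open {p : ℕ} [Fact p.Prime] {B : Type*} [NormedCommRing B]
    [NormedAlgebra ℚ_[p] B] [CompleteSpace B] (A : Subring B) {D ε : ℝ}
    (hD : ∀ b ∈ A, ‖b‖ ≤ D) (hε : 0 < ε) (hA : ∀ b, ‖b‖ ≤ ε → b ∈ A) :
    IsAdicComplete (Ideal.span {(p : A)}) A := by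
  have hp : (1 : ℝ) < p := by exact_mod_cast (Fact.out : p.Prime).one_lt
  have hclosed : IsClosed (A : Set B) := by
    refine (A.toAddSubgroup : AddSubgroup B).isClosed_of_isOpen ?_
    refine A.toAddSubgroup.isOpen_of_mem_nhds (g := 0) ?_
    exact Filter.mem_of_superset (Metric.closedBall_mem_nhds 0 hε)
      fun b hb => hA b (by simpa using hb)
  have hD0 : 0 ≤ D := (norm_nonneg _).trans (hD 1 A.one_mem)
  have hsmall : ∀ (n : ℕ) (a : A), (p : A) ^ n ∣ a → ‖(a : B)‖ ≤ ((p : ℝ)⁻¹) ^ n * D := by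
    rintro n _ ⟨c, rfl⟩
    have : (((p : A) ^ n * c : A) : B) = (p : B) ^ n * c := by push_cast; rfl
    rw [this, norm_natCast_pow_mul]
    exact mul_le_mul_of_nonneg_left (hD _ c.2) (by positivity)
  refine { haus' := fun x hx => ?_, prec' := fun {f} hf => ?_ }
  · simp only [smul_eq_mul, Ideal.mul_top, SModEq.sub_mem, Ideal.span_singleton_pow,
        Ideal.mem_span_singleton, sub_zero] at hx
    have : ‖(x : B)‖ ≤ 0 :=
      ge_of_tendsto' (tendsto_inv_pow_mul (p := p) D) fun n => hsmall n x (hx n)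
    exact Subtype.ext (norm_le_zero_iff.1 this)
  · simp only [smul_eq_mul, Ideal.mul_top, SModEq.sub_mem, Ideal.span_singleton_pow,
        Ideal.mem_span_singleton] at hf ⊢
    have hcau : CauchySeq fun n => (f n : B) := by
      refine Metric.cauchySeq_iff'.2 fun η hη => ?_
      obtain ⟨N, hN⟩ := ((tendsto_inv_pow_mul (p := p) D).eventually_lt_const hη).exists
      refine ⟨N, fun n hn => ?_⟩
      rw [dist_comm, dist_eq_norm]
      exact (hsmall N (f N - f n) (hf hn)).trans_lt hN
    obtain ⟨L, hL⟩ := cauchySeq_tendsto_of_complete hcau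
    refine ⟨⟨L, hclosed.mem_of_tendsto hL (Eventually.of_forall fun n => (f n).2)⟩, fun n => ?_⟩
    -- Division by `p^n` is possible in `B`. The quotient lies in `A`: it is the quotient of `f n -
    -- f m`, in `A` by the Cauchy condition, plus that of `f m - L`, in `A` by openness when `m` is
    -- large.
    obtain ⟨c, hc, -⟩ := exists_natCast_pow_mul_eq (p := p) n ((f n : B) - L)
    suffices c ∈ A from ⟨⟨c, this⟩, Subtype.ext (by push_cast; exact hc.symm)⟩
    have h1 : ∀ᶠ m in atTop, n ≤ m ∧ ‖(f m : B) - L‖ ≤ ε / (p : ℝ) ^ n := by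
      refine (eventually_ge_atTop n).and ?_
      filter_upwards [Metric.tendsto_nhds.1 hL (ε / (p : ℝ) ^ n) (by positivity)] with m hm
      rw [← dist_eq_norm]; exact hm.le
    obtain ⟨m, hnm, hm⟩ := h1.exists
    obtain ⟨g, hg⟩ := hf hnm
    obtain ⟨e, he, hen⟩ := exists_natCast_pow_mul_eq (p := p) n ((f m : B) - L)
    have heA : e ∈ A := hA e (by
      rw [hen]
      calc (p : ℝ) ^ n * ‖(f m : B) - L‖ ≤ (p : ℝ) ^ n * (ε / (p : ℝ) ^ n) :=
            mul_le_mul_of_nonneg_left hm (by positivity)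
        _ = ε := by field_simp)
    have hg' : (f n : B) - f m = (p : B) ^ n * g := by
      have := congrArg A.subtype hg
      simpa using this
    have hu : IsUnit ((p : B) ^ n) := by
      rw [← map_natCast (algebraMap ℚ_[p] B)]
      exact ((Nat.cast_ne_zero.2 (Fact.out : p.Prime).ne_zero).isUnit.map _).pow n
    have : c = g + e := hu.mul_left_cancel (by rw [hc, mul_add, ← hg', he]; ring)
    rw [this]
    exact A.add_mem g.2 heA

end Bounded

/-! ### The universal property of `A_inf` for Banach thickenings -/

section AInfUniversal

theorem not_isUnit_natCast_of_ringHom {p : ℕ} {A R : Type*} [CommRing A] [CommRing R] (φ : A →+* R)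
    [h : Fact (¬ IsUnit (p : R))] : Fact (¬ IsUnit (p : A)) :=
  ⟨fun h' => h.out (by simpa using h'.map φ)⟩

variable {p : ℕ} [Fact p.Prime] {R : Type*} [CommRing R]
  [IsAdicComplete (Ideal.span {(p : R)}) R] {Q : Type*} [CommRing Q] {ι : R →+* Q}
  {B : Type*} [NormedCommRing B] [NormedAlgebra ℚ_[p] B] [IsUltrametricDist B] [CompleteSpace B]

/-- A Banach thickening of `R[1/p]` is, integrally, a `p`-adically complete thickening of `R`; one
can moreover prescribe a bounded set of elements over `R`. -/
theorem exists_integral_thickening (hι : Function.Injective ι) {θ : B →+* Q}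
    (hθ : @Continuous _ _ _ (latticeTopology p ι) θ) (hs : Function.Surjective θ) {N : ℕ}
    (hN : RingHom.ker θ ^ N = ⊥) (M₀ : ℝ) :
    ∃ (A : Subring B) (φ : A →+* R), IsAdicComplete (Ideal.span {(p : A)}) A ∧
      Function.Surjective φ ∧ RingHom.ker φ ^ N = ⊥ ∧ (∀ a, ι (φ a) = θ a) ∧
      (∀ b, θ b ∈ ι.range → ‖b‖ ≤ M₀ → b ∈ A) ∧ ∃ D, ∀ a ∈ A, ‖a‖ ≤ D := by
  obtain ⟨M₁, hM₁⟩ := exists_bounded_lift hι hθ hs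
  -- Large enough for the prescribed elements, for the lifts from the open mapping theorem, and for
  -- the unit that starts each product.
  let M := max (max M₀ M₁) ‖(1 : B)‖
  have hlift : ∀ x ∈ ι.range, ∃ b, θ b = x ∧ ‖b‖ ≤ M := by
    rintro _ ⟨x, rfl⟩
    obtain ⟨b, hb, hbM⟩ := hM₁ x
    exact ⟨b, hb, hbM.trans ((le_max_right _ _).trans (le_max_left _ _))⟩
  obtain ⟨C, hC, h⟩ := exists_bound_mul_prod θ ι.range (M := M)
    ((norm_nonneg _).trans (le_max_right _ _)) (le_max_right _ _) hlift N 0 (by simpa using hN)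
  let P : Submonoid B := Submonoid.closure {b | θ b ∈ ι.range ∧ ‖b‖ ≤ M}
  have hP : ∀ g ∈ P, ‖g‖ ≤ ‖(1 : B)‖ * C := by
    intro g hg
    obtain ⟨l, hl, rfl⟩ := Submonoid.exists_list_of_mem_closure hg
    simpa using h 1 (by simp) l hl
  obtain ⟨δ, hδ, hδ'⟩ := exists_ball_of_continuous hθ 0
  let A := multiplierRing θ ι.range P
  obtain ⟨ε, hε, hεA⟩ := exists_ball_subset_multiplierRing (θ := θ) (R := ι.range) hP hδ
    fun b hb => by
      obtain ⟨y, hy⟩ := hδ' b hb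
      exact ⟨_, hy⟩
  obtain ⟨D, hD⟩ := exists_bound_multiplierRing p (θ := θ) (R := ι.range) hP
  have hmem : ∀ b, θ b ∈ ι.range → ‖b‖ ≤ M → b ∈ A := fun b hb hbM =>
    mem_multiplierRing hb (Submonoid.subset_closure ⟨hb, hbM⟩)
  let e : R ≃+* ι.range := RingEquiv.ofBijective ι.rangeRestrict
    ⟨fun x y hxy => hι (congrArg Subtype.val hxy), ι.rangeRestrict_surjective⟩
  let φ : A →+* R := (e.symm : ι.range →+* R).comp
    ((θ.comp A.subtype).codRestrict ι.range fun a => a.2.1)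
  have hφ : ∀ a, ι (φ a) = θ a := fun a =>
    congrArg Subtype.val (e.apply_symm_apply ⟨θ a, a.2.1⟩)
  refine ⟨A, φ, isAdicComplete_of_bounded_open A hD hε hεA, fun x => ?_, ?_, hφ,
    fun b hb hbM => hmem b hb (hbM.trans ((le_max_left _ _).trans (le_max_left _ _))), D, hD⟩
  · obtain ⟨b, hb, hbM⟩ := hlift (ι x) ⟨x, rfl⟩
    exact ⟨⟨b, hmem b ⟨x, hb.symm⟩ hbM⟩, hι ((hφ _).trans hb)⟩
  · have h1 : (RingHom.ker φ).map A.subtype ≤ RingHom.ker θ := by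
      rw [Ideal.map_le_iff_le_comap]
      intro a ha
      rw [RingHom.mem_ker] at ha
      rw [Ideal.mem_comap, RingHom.mem_ker]
      exact (hφ a).symm.trans (by rw [ha, map_zero])
    rw [eq_bot_iff]
    intro a ha
    have h2 := Ideal.pow_right_mono h1 N (Ideal.map_pow A.subtype (RingHom.ker φ) N ▸
      Ideal.mem_map_of_mem A.subtype ha)
    rw [hN, Ideal.mem_bot] at h2
    exact Subtype.ext h2

variable [Fact (¬ IsUnit (p : R))]

theorem exists_bounded_lift_fontaineTheta (hι : Function.Injective ι) {θ : B →+* Q}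
    (hθ : @Continuous _ _ _ (latticeTopology p ι) θ) (hs : Function.Surjective θ) {N : ℕ}
    (hN : RingHom.ker θ ^ N = ⊥) :
    ∃ f : AInf R p →+* B, θ.comp f = ι.comp (WittVector.fontaineTheta R p) ∧
      ∃ D, ∀ y, ‖f y‖ ≤ D := by
  obtain ⟨A, φ, hA, hφs, hφN, hφ, -, D, hD⟩ := exists_integral_thickening (p := p) hι hθ hs hN 0
  have := not_isUnit_natCast_of_ringHom (p := p) φ
  obtain ⟨f, hf⟩ := exists_lift_fontaineTheta (p := p) hφs hφN
  refine ⟨A.subtype.comp f, ?_, D, fun y => hD _ (f y).2⟩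
  ext1 x
  rw [← hf]
  exact (hφ (f x)).symm

/-- One integral thickening can be chosen to contain the images of both maps, and uniqueness is then
the statement for Witt vectors. -/
theorem bounded_lift_fontaineTheta_unique (hι : Function.Injective ι) {θ : B →+* Q}
    (hθ : @Continuous _ _ _ (latticeTopology p ι) θ) (hs : Function.Surjective θ) {N : ℕ}
    (hN : RingHom.ker θ ^ N = ⊥) {f g : AInf R p →+* B}
    (hf : θ.comp f = ι.comp (WittVector.fontaineTheta R p))
    (hg : θ.comp g = ι.comp (WittVector.fontaineTheta R p))
    {C D : ℝ} (hC : ∀ y, ‖f y‖ ≤ C) (hD : ∀ y, ‖g y‖ ≤ D) : f = g := by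
  obtain ⟨A, φ, hA, hφs, hφN, hφ, hmem, -⟩ :=
    exists_integral_thickening (p := p) hι hθ hs hN (max C D)
  have := not_isUnit_natCast_of_ringHom (p := p) φ
  have hf' : ∀ y, f y ∈ A := fun y => hmem _ ⟨_, (congrArg (fun F => F y) hf).symm⟩
    ((hC y).trans (le_max_left _ _))
  have hg' : ∀ y, g y ∈ A := fun y => hmem _ ⟨_, (congrArg (fun F => F y) hg).symm⟩
    ((hD y).trans (le_max_right _ _))
  have h : f.codRestrict A hf' = g.codRestrict A hg' := by
    refine wittVector_hom_ext_of_nilpotent_ker φ hφN ?_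
    ext1 x
    refine hι ?_
    simp only [RingHom.comp_apply, hφ]
    exact congrArg (fun F => F x) (hf.trans hg.symm)
  ext1 x
  exact congrArg (fun F => ((F x : A) : B)) h

end AInfUniversal

/-! ### The universal property of `B_dR⁺` -/

section BdRUniversal

variable {R : Type u} [CommRing R] {p : ℕ} [Fact p.Prime]
  [Fact (¬ IsUnit (p : R))] [IsAdicComplete (Ideal.span {(p : R)}) R]

theorem BdRPlus.factor_proj {m n : ℕ} (h : m ≤ n) (x : BDeRhamPlus R p) :
    Ideal.Quotient.factor (Ideal.pow_le_pow_right h) (BdRPlus.proj R p n x) =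
      BdRPlus.proj R p m x := by
  change Ideal.Quotient.factor _ (AdicCompletion.evalₐ (kerTheta R p) n x) =
    AdicCompletion.evalₐ (kerTheta R p) m x
  induction x using AdicCompletion.induction_on with
  | _ x => rw [AdicCompletion.evalₐ_mk, AdicCompletion.evalₐ_mk, Ideal.Quotient.factor_mk,
      AdicCompletion.Ideal.mk_eq_mk _ h]

variable (R p) in
/-- The map `A_inf[1/p] → B_dR⁺`. -/
noncomputable def BdRPlus.of : InvertP p (AInf R p) →+* BDeRhamPlus R p :=
  algebraMap (InvertP p (AInf R p)) (AdicCompletion (kerTheta R p) (InvertP p (AInf R p)))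

@[simp] theorem BdRPlus.proj_of (n : ℕ) (a : InvertP p (AInf R p)) :
    BdRPlus.proj R p n (BdRPlus.of R p a) = Ideal.Quotient.mk _ a :=
  (AdicCompletion.evalₐ (kerTheta R p) n).commutes a

theorem BdRPlus.theta_eq {n : ℕ} (hn : 1 ≤ n) {x : BDeRhamPlus R p} {a : InvertP p (AInf R p)}
    (h : BdRPlus.proj R p n x = Ideal.Quotient.mk _ a) :
    BdRPlus.theta R p x = fontaineThetaInvertP R p a := by
  rw [BdRPlus.theta, RingHom.comp_apply, ← BdRPlus.factor_proj hn, h, Ideal.Quotient.factor_mk]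
  exact Ideal.Quotient.lift_mk _ _ fun a ha => by rwa [pow_one] at ha

theorem BdRPlus.theta_of (a : InvertP p (AInf R p)) :
    BdRPlus.theta R p (BdRPlus.of R p a) = fontaineThetaInvertP R p a :=
  BdRPlus.theta_eq le_rfl (BdRPlus.proj_of 1 a)

theorem fontaineThetaInvertP_algebraMap (a : AInf R p) :
    fontaineThetaInvertP R p (algebraMap _ _ a) =
      algebraMap R (InvertP p R) (WittVector.fontaineTheta R p a) := by
  rw [fontaineThetaInvertP]
  exact IsLocalization.Away.lift_eq _ _ _

theorem fontaineThetaInvertP_surjective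
    (h : Function.Surjective (WittVector.fontaineTheta R p)) :
    Function.Surjective (fontaineThetaInvertP R p) := by
  intro y
  obtain ⟨n, r, hr⟩ := IsLocalization.Away.surj (p : R) y
  obtain ⟨a, rfl⟩ := h r
  have hu : IsUnit (algebraMap R (InvertP p R) p) := IsLocalization.Away.algebraMap_isUnit _
  refine ⟨algebraMap _ _ a * IsLocalization.Away.invSelf (p : AInf R p) ^ n, ?_⟩
  refine (hu.pow n).mul_right_cancel ?_
  rw [hr, map_mul, fontaineThetaInvertP_algebraMap, mul_assoc, map_natCast, ← map_natCast
    (fontaineThetaInvertP R p), ← map_pow, ← map_mul, ← mul_pow,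
    ← map_natCast (algebraMap (AInf R p) (InvertP p (AInf R p))),
    mul_comm (IsLocalization.Away.invSelf _), IsLocalization.Away.mul_invSelf, one_pow, map_one,
    mul_one]

theorem BdRPlus.theta_surjective (h : Function.Surjective (WittVector.fontaineTheta R p)) :
    Function.Surjective (BdRPlus.theta R p) := fun y => by
  obtain ⟨a, rfl⟩ := fontaineThetaInvertP_surjective h y
  exact ⟨_, BdRPlus.theta_of a⟩

/-- A ring homomorphism from `B_dR⁺` that factors continuously through a projection is
continuous. -/
theorem BdRPlus.continuous_comp_proj {X : Type*} [TopologicalSpace X] (n : ℕ)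
    {F : InvertP p (AInf R p) ⧸ kerTheta R p ^ n → X}
    (hF : @Continuous _ _ (latticeTopology p ((Ideal.Quotient.mk (kerTheta R p ^ n)).comp
      (algebraMap (AInf R p) (InvertP p (AInf R p))))) _ F) :
    Continuous fun x => F (BdRPlus.proj R p n x) :=
  @Continuous.comp _ _ _ _ (latticeTopology p ((Ideal.Quotient.mk (kerTheta R p ^ n)).comp
      (algebraMap (AInf R p) (InvertP p (AInf R p))))) _ _ _ hF
    (continuous_iInf_dom (i := n) continuous_induced_dom)

theorem BdRPlus.continuous_theta : Continuous (BdRPlus.theta R p) := by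
  have h : ∀ a ∈ kerTheta R p ^ 1, fontaineThetaInvertP R p a = 0 := fun a ha => by
    rwa [pow_one] at ha
  refine BdRPlus.continuous_comp_proj 1 (continuous_latticeTopology
    (Ideal.Quotient.lift (kerTheta R p ^ 1) (fontaineThetaInvertP R p) h) fun y => ?_)
  rw [RingHom.comp_apply, Ideal.Quotient.lift_mk, fontaineThetaInvertP_algebraMap]
  exact ⟨_, rfl⟩

theorem BdRPlus.continuous_of : Continuous (BdRPlus.of R p) := by
  refine continuous_iInf_rng.2 fun n => continuous_induced_rng.2 ?_
  have : BdRPlus.proj R p n ∘ BdRPlus.of R p = Ideal.Quotient.mk (kerTheta R p ^ n) :=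
    funext fun a => BdRPlus.proj_of n a
  rw [this]
  exact continuous_latticeTopology (Ideal.Quotient.mk (kerTheta R p ^ n)) fun y => ⟨y, rfl⟩

/-- A basic neighbourhood constrains only finitely many projections; a representative at the highest
of these levels matches them all exactly. -/
theorem BdRPlus.denseRange_of : DenseRange (BdRPlus.of R p) := by
  intro x
  rw [mem_closure_iff_nhds]
  intro U hU
  rw [BdRPlus.instTop, nhds_iInf, Filter.mem_iInf] at hU
  obtain ⟨I, hI, V, hV, rfl⟩ := hU
  obtain ⟨n, hn⟩ := hI.bddAbove
  obtain ⟨a, ha⟩ := Ideal.Quotient.mk_surjective (BdRPlus.proj R p n x)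
  refine ⟨BdRPlus.of R p a, Set.mem_iInter.2 fun i => ?_, a, rfl⟩
  obtain ⟨W, hW, hWV⟩ := (@mem_nhds_induced _ _ (latticeTopology p _) _ _ _).1 (hV i)
  refine hWV ?_
  rw [Set.mem_preimage, ← BdRPlus.factor_proj (hn i.2), BdRPlus.proj_of, ha,
    BdRPlus.factor_proj (hn i.2)]
  exact @mem_of_mem_nhds _ (latticeTopology p _) _ _ hW

variable {B : Type*} [NormedCommRing B] [NormedAlgebra ℚ_[p] B] [IsUltrametricDist B]
  [CompleteSpace B]

/-- The bounded lift on `A_inf` extends to `A_inf[1/p]` because `p` is invertible in `B`; it sends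
`Ker θ` into the nilpotent kernel, so it factors through a finite level. -/
theorem BdRPlus.exists_lift (hι : Function.Injective (algebraMap R (InvertP p R)))
    {θ : B →+* InvertP p R} (hθ : IsThickening θ) :
    ∃ α : BDeRhamPlus R p →+* B, Continuous α ∧ θ.comp α = BdRPlus.theta R p := by
  obtain ⟨k, hk⟩ := hθ.nilpotent
  obtain ⟨f, hf, D, hD⟩ := exists_bounded_lift_fontaineTheta (p := p) hι hθ.continuous
    hθ.surjective hk
  have hu : IsUnit (f p) := by
    rw [map_natCast, ← map_natCast (algebraMap ℚ_[p] B)]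
    exact (Nat.cast_ne_zero.2 (Fact.out : p.Prime).ne_zero).isUnit.map _
  let F : InvertP p (AInf R p) →+* B := IsLocalization.Away.lift (p : AInf R p) hu
  have hFf : ∀ y, F (algebraMap _ _ y) = f y := fun y => IsLocalization.Away.lift_eq _ _ _
  have hF : θ.comp F = fontaineThetaInvertP R p := by
    refine IsLocalization.ringHom_ext (Submonoid.powers (p : AInf R p)) ?_
    ext1 y
    simp only [RingHom.comp_apply]
    rw [hFf, fontaineThetaInvertP_algebraMap]
    exact congrArg (fun G => G y) hf
  have hker : ∀ a ∈ kerTheta R p ^ (k + 1), F a = 0 := by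
    intro a ha
    have h1 : (kerTheta R p).map F ≤ RingHom.ker θ := by
      rw [Ideal.map_le_iff_le_comap]
      intro b hb
      rw [RingHom.mem_ker, ← hF] at hb
      exact hb
    have h2 := Ideal.pow_right_mono h1 (k + 1) (Ideal.map_pow F _ (k + 1) ▸
      Ideal.mem_map_of_mem F ha)
    rwa [hk, Ideal.mem_bot] at h2
  refine ⟨(Ideal.Quotient.lift _ F hker).comp (BdRPlus.proj R p (k + 1)), ?_, ?_⟩
  · refine BdRPlus.continuous_comp_proj (k + 1) (continuous_of_bounded
      (Ideal.Quotient.lift _ F hker) (C := D) fun y => ?_)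
    rw [RingHom.comp_apply, Ideal.Quotient.lift_mk, hFf]
    exact hD y
  · ext1 x
    obtain ⟨a, ha⟩ := Ideal.Quotient.mk_surjective (BdRPlus.proj R p (k + 1) x)
    rw [BdRPlus.theta_eq (Nat.le_add_left 1 k) ha.symm, RingHom.comp_apply, RingHom.comp_apply,
      ← ha, Ideal.Quotient.lift_mk, ← hF, RingHom.comp_apply]

theorem BdRPlus.lift_unique (hι : Function.Injective (algebraMap R (InvertP p R)))
    {θ : B →+* InvertP p R} (hθ : IsThickening θ) {α β : BDeRhamPlus R p →+* B}
    (hα : Continuous α) (hβ : Continuous β) (hα' : θ.comp α = BdRPlus.theta R p)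
    (hβ' : θ.comp β = BdRPlus.theta R p) : α = β := by
  obtain ⟨k, hk⟩ := hθ.nilpotent
  have key : ∀ γ : BDeRhamPlus R p →+* B, Continuous γ → θ.comp γ = BdRPlus.theta R p →
      (∃ C, ∀ y, ‖(γ.comp (BdRPlus.of R p)) (algebraMap (AInf R p) _ y)‖ ≤ C) ∧
      θ.comp ((γ.comp (BdRPlus.of R p)).comp (algebraMap (AInf R p) _)) =
        (algebraMap R (InvertP p R)).comp (WittVector.fontaineTheta R p) := by
    intro γ hγ hγ'
    refine ⟨exists_bound_of_continuous (hγ.comp BdRPlus.continuous_of), ?_⟩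
    ext1 y
    have := congrArg (fun G => G (BdRPlus.of R p (algebraMap _ _ y))) hγ'
    rw [BdRPlus.theta_of, fontaineThetaInvertP_algebraMap] at this
    exact this
  obtain ⟨⟨C, hC⟩, hα₁⟩ := key α hα hα'
  obtain ⟨⟨D, hD⟩, hβ₁⟩ := key β hβ hβ'
  have h1 := bounded_lift_fontaineTheta_unique (p := p) hι hθ.continuous hθ.surjective hk hα₁ hβ₁
    hC hD
  have h2 : α.comp (BdRPlus.of R p) = β.comp (BdRPlus.of R p) :=
    IsLocalization.ringHom_ext (Submonoid.powers (p : AInf R p)) h1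
  refine DFunLike.coe_injective (BdRPlus.denseRange_of.equalizer hα hβ ?_)
  exact congrArg DFunLike.coe h2

/-- The lifting property of `B_dR⁺(R)` with respect to the thickenings of `R[1/p]`. -/
theorem BdRPlus.existsUnique_lift (hι : Function.Injective (algebraMap R (InvertP p R)))
    {θ : B →+* InvertP p R} (hθ : IsThickening θ) :
    ∃! α : BDeRhamPlus R p →+* B, Continuous α ∧ θ.comp α = BdRPlus.theta R p := by
  obtain ⟨α, hα⟩ := BdRPlus.exists_lift hι hθ
  exact ⟨α, hα, fun β hβ => BdRPlus.lift_unique hι hθ hβ.1 hα.1 hβ.2 hα.2⟩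

end BdRUniversal

/-! ### Étale equations over the maximal étale extension -/

section Etale

open Polynomial

theorem etale_adjoinRoot {T : Type*} [CommRing T] {f : T[X]} (hf : f.Monic)
    (hu : IsUnit (AdjoinRoot.mk f (derivative f))) : Algebra.Etale T (AdjoinRoot f) := by
  obtain ⟨q, hq⟩ := hu.exists_right_inv
  obtain ⟨q, rfl⟩ := AdjoinRoot.mk_surjective q
  rw [← map_mul, ← map_one (AdjoinRoot.mk f), AdjoinRoot.mk_eq_mk] at hq
  obtain ⟨r, hr⟩ := hq
  -- The Bézout relation `f' q - f r = 1` makes the standard étale algebra with localisation at `1`,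
  -- which is `T[X]/(f)`.
  let P : StandardEtalePair T := ⟨f, hf, 1, q, -r, 0, by rw [pow_zero]; linear_combination hr⟩
  have hroot : P.HasMap (AdjoinRoot.root f) := ⟨by simp [P, AdjoinRoot.aeval_eq], by simp [P]⟩
  refine Algebra.Etale.of_equiv (A := P.Ring) (AlgEquiv.ofAlgHom (P.lift _ hroot)
    (AdjoinRoot.liftAlgHom f (Algebra.ofId T P.Ring) P.X P.hasMap_X.1) ?_ ?_)
  · ext
    exact (congrArg (P.lift _ hroot) (AdjoinRoot.liftAlgHom_root f _ _ P.hasMap_X.1)).trans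
      (P.lift_X _ hroot)
  · ext
    exact (congrArg (AdjoinRoot.liftAlgHom f _ _ P.hasMap_X.1) (P.lift_X _ hroot)).trans
      (AdjoinRoot.liftAlgHom_root ..)

/-- A monic polynomial whose derivative is invertible modulo it has a root in the maximal étale
extension. -/
theorem IsMaximalEtaleExtension.exists_root (S : Type u) {T : Type v} [CommRing S] [CommRing T]
    [Algebra S T] [IsMaximalEtaleExtension S T] [Nontrivial T] {f : T[X]} (hf : f.Monic)
    (hd : f.natDegree ≠ 0) (hu : IsUnit (AdjoinRoot.mk f (derivative f))) :
    ∃ y : T, f.eval y = 0 := by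
  have := etale_adjoinRoot hf hu
  have := hf.free_adjoinRoot
  have := hf.finite_adjoinRoot
  have : Nontrivial (AdjoinRoot f) := by
    refine Ideal.Quotient.nontrivial_iff.2 fun h => ?_
    rw [Ideal.span_singleton_eq_top, hf.isUnit_iff] at h
    exact hd (by rw [h, natDegree_one])
  obtain ⟨s⟩ := IsMaximalEtaleExtension.exists_section (S := S) (T := T) (AdjoinRoot f)
  refine ⟨s (AdjoinRoot.root f), ?_⟩
  have h1 : aeval (AdjoinRoot.root f) f = 0 := by simp [AdjoinRoot.aeval_eq]
  have h2 := congrArg s h1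
  rwa [← aeval_algHom_apply, map_zero, coe_aeval_eq_eval] at h2

/-- If `1 + a z` is invertible for all `z : O`, then `1 - a w` is invertible for all `w` integral
over `O`. -/
theorem isUnit_one_sub_mul_of_isIntegral {O U : Type*} [CommRing O] [CommRing U] [Algebra O U]
    {a : O} (h : ∀ z : O, IsUnit (algebraMap O U (1 + a * z))) {w : U} (hw : IsIntegral O w) :
    IsUnit (1 - algebraMap O U a * w) := by
  obtain ⟨g, hg, hgw⟩ := hw
  rcases subsingleton_or_nontrivial O with hO | hO
  · have := (algebraMap O U).codomain_trivial
    exact isUnit_of_subsingleton _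
  -- The monic polynomial `scaleRoots g a` has root `a w`, so `1 - a w` divides its value at `1`.
  -- That value is `1` modulo `a`, since all lower coefficients are divisible by `a`.
  have h1 : aeval (algebraMap O U a * w) (scaleRoots g a) = 0 :=
    scaleRoots_aeval_eq_zero (by rwa [aeval_def])
  have h2 : 1 - algebraMap O U a * w ∣ aeval (1 : U) (scaleRoots g a) := by
    have := sub_dvd_eval_sub (1 : U) (algebraMap O U a * w) ((scaleRoots g a).map (algebraMap O U))
    rwa [eval_map_algebraMap, eval_map_algebraMap, h1, sub_zero] at this
  refine isUnit_of_dvd_unit h2 ?_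
  have h3 : a ∣ (scaleRoots g a).eval 1 - 1 := by
    rw [eval_eq_sum_range, natDegree_scaleRoots, Finset.sum_range_succ]
    simp only [coeff_scaleRoots, one_pow, mul_one, hg.coeff_natDegree, Nat.sub_self, pow_zero,
      add_sub_cancel_right]
    refine Finset.dvd_sum fun i hi => Dvd.dvd.mul_left (dvd_pow_self a ?_) _
    have := Finset.mem_range.1 hi
    omega
  obtain ⟨z, hz⟩ := h3
  have h4 : aeval (1 : U) (scaleRoots g a) = algebraMap O U (1 + a * z) := by
    rw [← hz, add_sub_cancel, ← map_one (algebraMap O U), aeval_algebraMap_apply, coe_aeval_eq_eval]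
  rw [h4]
  exact h z

end Etale

/-! ### The ring of integers -/

section Integers

variable {S : Type u} [NormedCommRing S] {T : Type v} [CommRing T] [Algebra S T]

theorem GrowthBd.map {T' : Type*} [CommRing T'] [Algebra S T'] (φ : T →ₐ[S] T') {x : T} {r : ℝ}
    (h : GrowthBd S x r) : GrowthBd S (φ x) r := by
  obtain ⟨ι, _, e, C, hC, hk⟩ := h
  refine ⟨ι, inferInstance, φ ∘ e, C, hC, fun k => ?_⟩
  obtain ⟨s, hs, hc⟩ := hk k
  refine ⟨s, ?_, hc⟩
  rw [← map_pow, ← hs, map_sum]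
  simp

variable (S T) in
theorem isUnit_natCast_of_normedAlgebra (p : ℕ) [Fact p.Prime] [NormedAlgebra ℚ_[p] S] :
    IsUnit (p : T) := by
  rw [← map_natCast (algebraMap S T), ← map_natCast (algebraMap ℚ_[p] S)]
  exact ((Nat.cast_ne_zero.2 (Fact.out : p.Prime).ne_zero).isUnit.map _).map _

variable [IsUltrametricDist S]

theorem map_mem_integers {T' : Type*} [CommRing T'] [Algebra S T'] (φ : T →ₐ[S] T') {x : T}
    (hx : x ∈ integers S T) : φ x ∈ integers S T' :=
  spectralSeminorm_le_of_growthBd fun _ hr => (growthBd_of_spectralSeminorm_le hx hr).map φ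

/-- A root `y` of `Y^(m+2) = a Y + x` is integral as soon as `x` is, for an integer `a`. -/
theorem mem_integers_of_pow_eq {x y : T} {m a : ℕ} (hx : x ∈ integers S T)
    (hy : y ^ (m + 2) = a * y + x) : y ∈ integers S T := by
  refine spectralSeminorm_le_of_growthBd fun r hr => ?_
  obtain ⟨ι, _, e, C, hC, hk⟩ := growthBd_of_spectralSeminorm_le hx hr
  -- Multiplying by `y` costs at most one more factor `x`, so `y^n` involves only `x^i` with `i ≤
  -- n`. Integer coefficients are free, the norm being ultrametric.
  let D : ℕ → AddSubmonoid T := fun n =>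
    AddSubmonoid.closure {t | ∃ i ≤ n, ∃ s < m + 2, t = x ^ i * y ^ s}
  have hmem : ∀ n i s, i ≤ n → s < m + 2 → x ^ i * y ^ s ∈ D n := fun n i s hi hs =>
    AddSubmonoid.subset_closure ⟨i, hi, s, hs, rfl⟩
  have hD : ∀ n, y ^ n ∈ D n := by
    intro n
    induction n with
    | zero => simpa using hmem 0 0 0 le_rfl (by omega)
    | succ n ih =>
      have hstep : ∀ t ∈ D n, t * y ∈ D (n + 1) := by
        intro t ht
        induction ht using AddSubmonoid.closure_induction with
        | mem t ht =>
          obtain ⟨i, hi, s, hs, rfl⟩ := ht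
          rw [mul_assoc, ← pow_succ]
          rcases Nat.lt_or_ge (s + 1) (m + 2) with h | h
          · exact hmem _ _ _ (by omega) h
          · obtain rfl : s = m + 1 := by omega
            have : x ^ i * y ^ (m + 1 + 1) = a • (x ^ i * y ^ 1) + x ^ (i + 1) * y ^ 0 := by
              rw [hy, nsmul_eq_mul]; ring
            rw [this]
            exact add_mem (nsmul_mem (hmem _ _ _ (by omega) (by omega)) _)
              (hmem _ _ _ (by omega) (by omega))
        | zero => simp
        | add t t' _ _ h h' => rw [add_mul]; exact add_mem h h'
      rw [pow_succ]
      exact hstep _ ih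
  refine ⟨ι × Fin (m + 2), inferInstance, fun i => e i.1 * y ^ (i.2 : ℕ), C * ‖(1 : S)‖,
    by positivity, fun n => ?_⟩
  have hbd : ∀ t ∈ D n, Bd S (fun i : ι × Fin (m + 2) => e i.1 * y ^ (i.2 : ℕ))
      (C * ‖(1 : S)‖ * r ^ n) t := by
    intro t ht
    induction ht using AddSubmonoid.closure_induction with
    | mem t ht =>
      obtain ⟨i, hi, s, hs, rfl⟩ := ht
      refine ((hk i).mul (Bd.basis (S := S) (fun j : Fin (m + 2) => y ^ (j : ℕ)) ⟨s, hs⟩)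
        (by positivity)).mono ?_
      rw [mul_right_comm]
      exact mul_le_mul_of_nonneg_left (pow_le_pow_right₀ hr.le hi) (by positivity)
    | zero => exact Bd.zero _ (by positivity)
    | add t t' _ _ h h' => exact h.add h'
  exact hbd _ (hD n)

variable {p : ℕ} [Fact p.Prime] [NormedAlgebra ℚ_[p] S]

/-- `p` is in the Jacobson radical of the ring of integers. -/
theorem isUnit_one_add_natCast_mul [CompleteSpace S] [Algebra.IsIntegral S T]
    (z : integers S T) : IsUnit (1 + (p : T) * z) := by
  -- Modulo `1 + pz` the integral element `-z` would be an inverse of `p`, which `not_mul_eq_one`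
  -- excludes in a nonzero integral `S`-algebra.
  by_contra h
  let I : Ideal T := Ideal.span {1 + (p : T) * z}
  have hI : Nontrivial (T ⧸ I) := Ideal.Quotient.nontrivial_iff.2 fun h' =>
    h (Ideal.span_singleton_eq_top.1 h')
  have : Algebra.IsIntegral S (T ⧸ I) :=
    Algebra.IsIntegral.of_surjective (Ideal.Quotient.mkₐ S I) Ideal.Quotient.mk_surjective
  have hp : (1 : ℝ) < p := by exact_mod_cast (Fact.out : p.Prime).one_lt
  refine not_mul_eq_one (S := S) (T := T ⧸ I) (p : S) (ρ := (p : ℝ)⁻¹) (C := ‖(1 : S)‖)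
    (by positivity) (inv_lt_one_of_one_lt₀ hp) (fun k => ?_)
    ⟨_, map_mem_integers (Ideal.Quotient.mkₐ S I) (-z).2⟩ ?_
  · simpa using (norm_natCast_pow_mul (p := p) k (1 : S)).le
  · have h1 : Ideal.Quotient.mk I (1 + (p : T) * z) = 0 :=
      Ideal.Quotient.eq_zero_iff_mem.2 (Ideal.mem_span_singleton_self _)
    rw [map_add, map_one, map_mul] at h1
    simp only [map_natCast, Ideal.Quotient.mkₐ_eq_mk, NegMemClass.coe_neg, map_neg] at h1 ⊢
    linear_combination -h1

open Polynomial in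
/-- The Frobenius is surjective on `O/p`, where `O` is the ring of integers of the maximal étale
extension. -/
theorem exists_pow_sub_dvd [CompleteSpace S] [Nontrivial T] [IsMaximalEtaleExtension S T]
    (x : integers S T) : ∃ z : integers S T, (p : integers S T) ∣ z ^ p - x := by
  have := IsMaximalEtaleExtension.isIntegral S T
  have hp2 : 2 ≤ p := (Fact.out : p.Prime).two_le
  obtain ⟨m, hm⟩ : ∃ m, p * p = m + 2 := Nat.exists_eq_add_of_le' (by nlinarith)
  -- The exponent is `p²` rather than `p` so that the derivative is `p (p X^(p²-1) - 1)`: `p` is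
  -- invertible in `T`, and the other factor is invertible at the integral root. A root `y` gives `z
  -- = y^p`, with `z^p - x = p y`.
  let f₀ : (integers S T)[X] := X ^ (m + 2) - (C (p : integers S T) * X + C x)
  have hdeg : (C (p : integers S T) * X + C x).degree < ((m + 2 : ℕ) : WithBot ℕ) :=
    degree_linear_le.trans_lt (Nat.cast_lt.2 (by omega : 1 < m + 2))
  have hf₀ : f₀.Monic := monic_X_pow_sub hdeg
  let f : T[X] := f₀.map (algebraMap (integers S T) T)
  have hf : f.Monic := hf₀.map _
  have hfeq : f = X ^ (m + 2) - ((p : T[X]) * X + C (x : T)) := by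
    simp only [f, f₀, Polynomial.map_sub, Polynomial.map_add, Polynomial.map_mul,
      Polynomial.map_pow, map_X, map_C, map_natCast, Polynomial.map_natCast]
    rfl
  have hnat : f.natDegree = m + 2 := by
    rw [hf₀.natDegree_map]
    have hlin : (C (p : integers S T) * X + C x).natDegree < m + 2 :=
      natDegree_linear_le.trans_lt (by omega)
    rw [natDegree_sub_eq_left_of_natDegree_lt (by rwa [natDegree_X_pow]), natDegree_X_pow]
  have hroot : IsIntegral (integers S T) (AdjoinRoot.root f) := by
    refine ⟨f₀, hf₀, ?_⟩
    have : algebraMap (integers S T) (AdjoinRoot f) =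
        (algebraMap T (AdjoinRoot f)).comp (algebraMap (integers S T) T) := rfl
    rw [this, ← eval₂_map]
    exact AdjoinRoot.eval₂_root f
  have hunit : IsUnit (AdjoinRoot.mk f (derivative f)) := by
    have h1 := isUnit_one_sub_mul_of_isIntegral (O := integers S T) (U := AdjoinRoot f)
      (a := (p : integers S T)) (fun z => by
        have := (isUnit_one_add_natCast_mul (p := p) z).map (algebraMap T (AdjoinRoot f))
        convert this using 1
        change algebraMap T (AdjoinRoot f) _ = _
        congr 1) (hroot.pow (m + 1))
    have h2 : AdjoinRoot.mk f (derivative f) =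
        -((p : AdjoinRoot f) * (1 - algebraMap (integers S T) (AdjoinRoot f) p *
          AdjoinRoot.root f ^ (m + 1))) := by
      have h3 : derivative f = (p : T[X]) * ((p : T[X]) * X ^ (m + 1) - 1) := by
        have h4 : ((m + 2 : ℕ) : T) = p * p := by rw [← hm]; push_cast; rfl
        rw [hfeq]
        simp only [derivative_sub, derivative_X_pow, derivative_add, derivative_natCast_mul,
          derivative_X, derivative_C, h4, map_mul, map_natCast]
        rw [show m + 2 - 1 = m + 1 from rfl]
        ring
      rw [h3]
      simp only [map_mul, map_sub, map_one, map_pow, AdjoinRoot.mk_X, map_natCast]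
      ring
    rw [h2]
    have h3 := (isUnit_natCast_of_normedAlgebra S T p).map (algebraMap T (AdjoinRoot f))
    rw [map_natCast] at h3
    exact (h3.mul h1).neg
  obtain ⟨y, hy⟩ := IsMaximalEtaleExtension.exists_root S hf (by omega) hunit
  have hy' : y ^ (m + 2) = (p : T) * y + x := by
    rw [hfeq] at hy
    simpa [sub_eq_zero] using hy
  have hyO : y ∈ integers S T := mem_integers_of_pow_eq x.2 hy'
  refine ⟨⟨y, hyO⟩ ^ p, ⟨y, hyO⟩, ?_⟩
  refine Subtype.ext ?_
  push_cast
  rw [← pow_mul, hm, hy']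
  ring

end Integers

/-! ### The completed ring of integers -/

section OHat

/-- Cancelling `a` loses one level of precision, so vanishing modulo `a^n` is read off from level `n
+ 1`. -/
theorem mem_nonZeroDivisors_adicCompletion {O : Type*} [CommRing O] {a : O}
    (ha : a ∈ nonZeroDivisors O) :
    algebraMap O (AdicCompletion (Ideal.span {a}) O) a ∈
      nonZeroDivisors (AdicCompletion (Ideal.span {a}) O) := by
  rw [mem_nonZeroDivisors_iff_right]
  intro x hx
  induction x using AdicCompletion.induction_on with
  | _ x =>
  refine AdicCompletion.ext_evalₐ fun n => ?_
  have h1 := congrArg (AdicCompletion.evalₐ (Ideal.span {a}) (n + 1)) hx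
  rw [map_mul, AdicCompletion.evalₐ_mk, AlgHom.commutes, Ideal.Quotient.algebraMap_eq,
    ← map_mul, map_zero, Ideal.Quotient.eq_zero_iff_mem, Ideal.span_singleton_pow,
    Ideal.mem_span_singleton] at h1
  obtain ⟨c, hc⟩ := h1
  rw [map_zero, AdicCompletion.evalₐ_mk, ← AdicCompletion.Ideal.mk_eq_mk _ n.le_succ,
    Ideal.Quotient.eq_zero_iff_mem, Ideal.span_singleton_pow, Ideal.mem_span_singleton]
  exact ⟨c, (mul_cancel_right_mem_nonZeroDivisors ha).1 (hc.trans (by ring))⟩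

variable (p : ℕ) [Fact p.Prime]
variable (S : Type u) [NormedCommRing S] [NormedAlgebra ℚ_[p] S] [IsUltrametricDist S]
variable (T : Type v) [CommRing T] [Algebra S T]

theorem natCast_mem_nonZeroDivisors_OHat : (p : OHat p S T) ∈ nonZeroDivisors (OHat p S T) := by
  have h : (p : integers S T) ∈ nonZeroDivisors (integers S T) := by
    rw [mem_nonZeroDivisors_iff_right]
    intro x hx
    have h1 : (x : T) * p = 0 := by simpa using congrArg (Subring.subtype _) hx
    exact Subtype.ext ((isUnit_natCast_of_normedAlgebra S T p).mul_left_eq_zero.1 h1)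
  simpa using mem_nonZeroDivisors_adicCompletion h

theorem algebraMap_OHat_injective :
    Function.Injective (algebraMap (OHat p S T) (InvertP p (OHat p S T))) :=
  IsLocalization.injective _
    (Submonoid.powers_le.2 (natCast_mem_nonZeroDivisors_OHat p S T))

variable [CompleteSpace S] [Nontrivial S] [IsMaximalEtaleExtension S T]

/-- Completion does not change the quotient by `p`, the ideal being finitely generated, so the
statement descends to the uncompleted ring of integers. -/
theorem frobenius_OHat_surjective :
    Function.Surjective (frobenius (ModP (OHat p S T) p) p) := by
  have : Nontrivial T := (IsMaximalEtaleExtension.injective (S := S) (T := T)).nontrivial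
  intro x
  obtain ⟨x, rfl⟩ := Ideal.Quotient.mk_surjective x
  obtain ⟨a, ha⟩ := Ideal.Quotient.mk_surjective
    (AdicCompletion.evalOneₐ (Ideal.span {(p : integers S T)}) x)
  obtain ⟨z, w, hw⟩ := exists_pow_sub_dvd (p := p) (S := S) (T := T) a
  refine ⟨Ideal.Quotient.mk _ (algebraMap _ _ z), ?_⟩
  rw [frobenius_def, ← map_pow, ← map_pow, sub_eq_iff_eq_add.1 hw, map_add, map_mul,
    map_natCast, Ideal.Quotient.eq]
  have h1 : x - algebraMap _ _ a ∈
      RingHom.ker (AdicCompletion.evalOneₐ (Ideal.span {(p : integers S T)})).toRingHom := by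
    rw [RingHom.mem_ker, map_sub, sub_eq_zero]
    exact ha.symm
  rw [AdicCompletion.ker_evalOneₐ_eq_map _ (Submodule.fg_span (Set.finite_singleton _)),
    Ideal.map_span, Set.image_singleton, map_natCast] at h1
  have h2 := sub_mem (Ideal.mul_mem_right (algebraMap (integers S T) (OHat p S T) w) _
    (Ideal.mem_span_singleton_self (p : OHat p S T))) h1
  convert h2 using 1
  ring

end OHat

end BdRThick


theorem mainTheorem2 (p : ℕ) [Fact p.Prime]
    {K : Type*} [NormedField K] [NormedAlgebra ℚ_[p] K] [IsUltrametricDist K] [CompleteSpace K]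
    {S : Type*} [NormedCommRing S] [IsUltrametricDist S] [CompleteSpace S]
    [NormedAlgebra ℚ_[p] S] [NormedAlgebra K S] [IsScalarTower ℚ_[p] K S]
    [Nontrivial S] [IsReduced S] (hS : BdRThick.IsAffinoid K S)
    {Sbar : Type*} [CommRing Sbar] [Algebra S Sbar] [BdRThick.IsMaximalEtaleExtension S Sbar] :
    (Continuous (BdRThick.BdRPlus.theta (BdRThick.OHat p S Sbar) p) ∧
      Function.Surjective (BdRThick.BdRPlus.theta (BdRThick.OHat p S Sbar) p)) ∧
    ∀ (B : Type*) [NormedCommRing B] [NormedAlgebra ℚ_[p] B] [IsUltrametricDist B]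
      [CompleteSpace B] (θB : B →+* BdRThick.InvertP p (BdRThick.OHat p S Sbar)),
      BdRThick.IsThickening θB →
        ∃! α : BDeRhamPlus (BdRThick.OHat p S Sbar) p →+* B,
          Continuous α ∧ θB.comp α = BdRThick.BdRPlus.theta (BdRThick.OHat p S Sbar) p :=
  ⟨⟨BdRThick.BdRPlus.continuous_theta, BdRThick.BdRPlus.theta_surjective
      (surjective_fontaineTheta (BdRThick.frobenius_OHat_surjective p S Sbar))⟩,
    fun _ _ _ _ _ _ hθ => BdRThick.BdRPlus.existsUnique_lift
      (BdRThick.algebraMap_OHat_injective p S Sbar) hθ⟩
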